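/- Let $\mathcal S$ be a measurable space. A p-concept over $\mathcal S$ is a function $\mathcal S\to[0,1]$ and a p-concept class is a set of p-concepts. For $\eta>0$, a finite set $\{s_1,\dots,s_k\}\subseteq\mathcal S$ of $k$ points is $\eta$-fat-shattered by a class $\mathcal C$ if there are reals $a_1,\dots,a_k$ such that for every $B\subseteq\{1,\dots,k\}$ some $F\in\mathcal C$ satisfies $F(s_i)\le a_i-\eta$ for all $i\notin B$ and $F(s_i)\ge a_i+\eta$ for all $i\in B$; $\operatorname{fat}_{\mathcal C}(\eta)\in\{0,1,\dots\}\cup\{\infty\}$ is the largest such $k$, or $\infty$ if there is no finite maximum. For a probability measure $\mathcal D$ on $\mathcal S$, call $\mathcal C$ $\mathcal D$-measurable if every $H\in\mathcal C$ is measurable and, for every $n$ and every open $U\subseteq[0,1]^n$, the set $\{x\in\mathcal S^n:\exists H\in\mathcal C,\ (H(x_1),\dots,H(x_n))\in U\}$ is measurable for the completion of $\mathcal D^n$ (given that all members are measurable, the second condition is automatic if, for instance, $\mathcal C$ is countable, or every member of $\mathcal C$ is the pointwise limit of a sequence from a fixed countable subclass of $\mathcal C$). **Theorem.** For every $c<1$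 there is a constant $K>0$, depending only on $c$, such that the following holds. Let $\mathcal S$ be a measurable space, $\mathcal D$ a probability measure on $\mathcal S$, $\mathcal C$ a $\mathcal D$-measurable p-concept class, $F\in\mathcal C$, and let $\varepsilon,\gamma,\delta>0$ with $\gamma\varepsilon\le c$. Let $x_1,\dots,x_m$ be drawn independently from $\mathcal D$ and let $b_1,\dots,b_m\in\{0,1\}$ be such that, given the $x_i$'s, the $b_i$ are independent with $\Pr[b_i=1]=F(x_i)$. If $\operatorname{fat}_{\mathcal C}(\gamma^2\varepsilon/10)<\infty$ and $$m\ \ge\ \frac{K}{\gamma^4\varepsilon^2}\left(\operatorname{fat}_{\mathcal C}\!\left(\frac{\gamma^2\varepsilon}{10}\right)\log^2\frac1{\gamma\varepsilon}+\log\frac1\delta\right),$$ then with probability at least $1-\delta$ over $(x_i,b_i)_{i\le m}$ (that is, on some measurable event of probability at least $1-\delta$), every $H\in\mathcal C$ that minimizes $\sum_{i=1}^m (H(x_i)-b_i)^2$ over $\mathcal C$ satisfies $$\Pr_{x\sim\mathcal D}\bigl[\,|H(x)-F(x)|>\gamma\,\bigr]\le\varepsilon .$$ -/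

import Mathlib

open MeasureTheory

/-- A p-concept over the sample space `S`: a function `S → [0,1]`. -/
abbrev PConcept (S : Type*) := S → unitInterval

/-- The finite set `s` is `η`-fat-shattered by the class `C`. -/
def FatShatters {S : Type*} (C : Set (PConcept S)) (η : ℝ) (s : Finset S) : Prop :=
  ∃ a : S → ℝ, ∀ B ⊆ s, ∃ F ∈ C, ∀ x ∈ s,
    (x ∉ B → (F x : ℝ) ≤ a x - η) ∧ (x ∈ B → a x + η ≤ (F x : ℝ))

/-- The `η`-fat-shattering dimension of `C`: the largest cardinality of an `η`-fat-shattered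
finite set, and `⊤` if there is no finite maximum. -/
noncomputable def fatDim {S : Type*} (C : Set (PConcept S)) (η : ℝ) : ℕ∞ :=
  ⨆ s ∈ {s : Finset S | FatShatters C η s}, (s.card : ℕ∞)

/-- The numerical value of a bit. -/
def bitVal (b : Bool) : ℝ := if b then 1 else 0

/-- The law of a labelled example `(x, b)`: `x` has law `D` and, given `x`, the bit `b` is `1`
with probability `F x` and `0` with probability `1 - F x`. -/
noncomputable def labelledLaw {S : Type*} [MeasurableSpace S] (D : Measure S) (F : PConcept S) :
    Measure (S × Bool) :=
  (D.withDensity fun x => ENNReal.ofReal (F x)).map (fun x => (x, true)) +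
    (D.withDensity fun x => ENNReal.ofReal (1 - F x)).map (fun x => (x, false))

/-- The law of `m` independent labelled examples. -/
noncomputable def sampleLaw {S : Type*} [MeasurableSpace S] (D : Measure S) (F : PConcept S)
    (m : ℕ) : Measure (Fin m → S × Bool) :=
  Measure.pi fun _ => labelledLaw D F

/-- The quadratic functional `∑ i, (H (x i) - b i) ^ 2` of a hypothesis on a labelled sample. -/
noncomputable def quadraticLoss {S : Type*} {m : ℕ} (z : Fin m → S × Bool) (H : PConcept S) : ℝ :=
  ∑ i, ((H (z i).1 : ℝ) - bitVal (z i).2) ^ 2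

/-- Measurability convention for a p-concept class: every member is measurable, and for every `n`
and every open `U ⊆ [0,1]^n` the event that some member of the class takes values in `U` on
`(x 1, …, x n)` is measurable for the completion of `D ^ n`. The second part follows from the first
when `C` is countable, or more generally when every member of `C` is the pointwise limit of a sequence
from a fixed countable subclass of `C`. -/
structure MeasurableClass {S : Type*} [MeasurableSpace S] (C : Set (PConcept S)) (D : Measure S) :
    Prop where
  measurable_mem : ∀ H ∈ C, Measurable H
  nullMeasurable_hit : ∀ (n : ℕ) (U : Set (Fin n → unitInterval)), IsOpen U →
    NullMeasurableSet {x : Fin n → S | ∃ H ∈ C, (fun i => H (x i)) ∈ U} (Measure.pi fun _ => D)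

/-! Since a label has conditional mean `F x`, the expected excess quadratic loss of `H` over `F` is
`∫ (H - F)^2`. A minimizer has empirical excess at most `0`, because `F` itself competes. Put `η =
γ^2 ε / 10`. By Markov it suffices that, with probability `1 - δ`, no `H` with `∫ (H - F)^2 > 10 η`
has nonpositive empirical excess (`exists_good_event`).

A ghost sample of the same size has total excess above `9 η m` with probability at least `1/2`, by
Chebyshev, so a bad `H` separates the two halves. Swapping paired examples at random turns the
difference into a Rademacher sum. A net in the empirical `L¹` distance at radius `11 η / 5` costs
`44 η m / 5`, and Hoeffding handles the remaining `η m / 5` (`card_swaps_mem_deviationEvent_le`).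

The net is bounded in terms of the fat-shattering dimension `d` at scale exactly `η`. After
quantization, a separated family of size `M^r` shatters at least `2^r` patterns of level pairs
(`PairwiseSeparated.two_pow_le_card_shatteredPatterns`), while every such pattern has support at
most `d`, which limits their number (`card_packing_lt`). The log-size of the net is thus about `d
log(m / (d η^2)) log(1/η)`, and the sample size absorbs it. -/

/-! ### Counting shattered patterns of finite-valued functions. -/

section Combinatorics

open Finset Classical

variable {ι L : Type*}

/-- The partial assignments `p` of `R`-related pairs of levels to coordinates which are shattered
by `T`: every choice of lower or upper level on the domain of `p` is realised by a member of `T`. -/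
noncomputable def shatteredPatterns [Fintype ι] [Fintype L] (R : L → L → Prop) (T : Finset (ι → L)) :
    Finset (ι → Option (L × L)) :=
  univ.filter fun p => (∀ i w, p i = some w → R w.1 w.2) ∧
    ∀ B : Set ι, ∃ f ∈ T, ∀ i w, p i = some w → (i ∈ B → f i = w.2) ∧ (i ∉ B → f i = w.1)

theorem mem_shatteredPatterns [Fintype ι] [Fintype L] {R : L → L → Prop} {T : Finset (ι → L)}
    {p : ι → Option (L × L)} : p ∈ shatteredPatterns R T ↔
    (∀ i w, p i = some w → R w.1 w.2) ∧
    ∀ B : Set ι, ∃ f ∈ T, ∀ i w, p i = some w → (i ∈ B → f i = w.2) ∧ (i ∉ B → f i = w.1) := by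
  simp [shatteredPatterns]

theorem shatteredPatterns_mono [Fintype ι] [Fintype L] (R : L → L → Prop) {T T' : Finset (ι → L)} (h : T ⊆ T') :
    shatteredPatterns R T ⊆ shatteredPatterns R T' := by
  intro p hp
  rw [mem_shatteredPatterns] at hp ⊢
  refine ⟨hp.1, fun B => ?_⟩
  obtain ⟨f, hf, h'⟩ := hp.2 B
  exact ⟨f, h hf, h'⟩

/-- All members of the fibre agree at `i`, so an assigned pair there would be `(u, u)`, against
irreflexivity. -/
theorem eq_none_of_mem_shatteredPatterns [Fintype ι] [Fintype L] {R : L → L → Prop} (hR : ∀ u, ¬ R u u)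
    {T : Finset (ι → L)} {i : ι} {u : L} {p : ι → Option (L × L)}
    (hp : p ∈ shatteredPatterns R (T.filter fun f => f i = u)) : p i = none := by
  rw [mem_shatteredPatterns] at hp
  by_contra hne
  obtain ⟨w, hw⟩ := Option.ne_none_iff_exists'.1 hne
  obtain ⟨f, hf, h1⟩ := hp.2 Set.univ
  obtain ⟨f', hf', h2⟩ := hp.2 ∅
  have e1 := (h1 i w hw).1 (Set.mem_univ _)
  have e2 := (h2 i w hw).2 (Set.notMem_empty _)
  have := hp.1 i w hw
  rw [← e1, ← e2, (mem_filter.1 hf).2, (mem_filter.1 hf').2] at this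
  exact hR u this

/-- Patterns of either fibre leave `i` free and are shattered by `T`. Those common to both fibres
give a further pattern each when `(u, v)` is assigned at `i`: the two fibres supply the two choices.
This makes up for `|P| + |Q| = |P ∪ Q| + |P ∩ Q|`. -/
theorem card_shatteredPatterns_add_le [Fintype ι] [Fintype L] {R : L → L → Prop} (hR : ∀ u, ¬ R u u)
    (T : Finset (ι → L)) (i : ι) {u v : L} (huv : R u v) :
    (shatteredPatterns R (T.filter fun f => f i = u)).card +
      (shatteredPatterns R (T.filter fun f => f i = v)).card ≤ (shatteredPatterns R T).card := by
  set P := shatteredPatterns R (T.filter fun f => f i = u) with hP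
  set Q := shatteredPatterns R (T.filter fun f => f i = v) with hQ
  have hPn : ∀ p ∈ P, p i = none := fun p hp => eq_none_of_mem_shatteredPatterns hR hp
  have hQn : ∀ p ∈ Q, p i = none := fun p hp => eq_none_of_mem_shatteredPatterns hR hp
  let e : (ι → Option (L × L)) → (ι → Option (L × L)) := fun p => Function.update p i (some (u, v))
  have hinj : Set.InjOn e (P ∩ Q : Finset _) := by
    intro p hp q hq h
    have hp' := hPn p (mem_inter.1 hp).1
    have hq' := hPn q (mem_inter.1 hq).1
    funext j
    by_cases hj : j = i
    · rw [hj, hp', hq']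
    · have := congrFun h j
      simpa [e, hj] using this
  have hdisj : Disjoint (P ∪ Q) ((P ∩ Q).image e) := by
    rw [Finset.disjoint_left]
    intro p hp hp'
    obtain ⟨q, -, rfl⟩ := mem_image.1 hp'
    have : e q i = none := by
      rcases mem_union.1 hp with h | h
      · exact hPn _ h
      · exact hQn _ h
    simp [e] at this
  have hsub : (P ∪ Q) ∪ (P ∩ Q).image e ⊆ shatteredPatterns R T := by
    refine union_subset (union_subset (shatteredPatterns_mono R (filter_subset _ _))
      (shatteredPatterns_mono R (filter_subset _ _))) ?_
    intro p' hp'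
    obtain ⟨p, hp, rfl⟩ := mem_image.1 hp'
    have hp1 := mem_shatteredPatterns.1 (mem_inter.1 hp).1
    have hp2 := mem_shatteredPatterns.1 (mem_inter.1 hp).2
    rw [mem_shatteredPatterns]
    refine ⟨fun j w hw => ?_, fun B => ?_⟩
    · by_cases hj : j = i
      · subst hj
        have : (u, v) = w := by simpa [e] using hw
        subst this
        exact huv
      · exact hp1.1 j w (by simpa [e, hj] using hw)
    · by_cases hi : i ∈ B
      · obtain ⟨f, hf, h⟩ := hp2.2 B
        rw [mem_filter] at hf
        refine ⟨f, hf.1, fun j w hw => ?_⟩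
        by_cases hj : j = i
        · subst hj
          have : (u, v) = w := by simpa [e] using hw
          subst this
          exact ⟨fun _ => hf.2, fun h => absurd hi h⟩
        · exact h j w (by simpa [e, hj] using hw)
      · obtain ⟨f, hf, h⟩ := hp1.2 B
        rw [mem_filter] at hf
        refine ⟨f, hf.1, fun j w hw => ?_⟩
        by_cases hj : j = i
        · subst hj
          have : (u, v) = w := by simpa [e] using hw
          subst this
          exact ⟨fun h => absurd h hi, fun _ => hf.2⟩
        · exact h j w (by simpa [e, hj] using hw)
  calc P.card + Q.card = (P ∪ Q).card + (P ∩ Q).card := (card_union_add_card_inter P Q).symm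
    _ = (P ∪ Q).card + ((P ∩ Q).image e).card := by rw [card_image_of_injOn hinj]
    _ = ((P ∪ Q) ∪ (P ∩ Q).image e).card := (card_union_of_disjoint hdisj).symm
    _ ≤ _ := card_le_card hsub

/-- Any two distinct members of `T` are `R`-related, in one order or the other, on at least a
fraction `κ` of the coordinates. -/
def PairwiseSeparated [Fintype ι] (R : L → L → Prop) (κ : ℝ) (T : Finset (ι → L)) : Prop :=
  ∀ f ∈ T, ∀ g ∈ T, f ≠ g →
    κ * Fintype.card ι ≤ ((univ.filter fun i => R (f i) (g i) ∨ R (g i) (f i)).card : ℝ)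

theorem card_filter_rel_le [Fintype L] (R : L → L → Prop) (T : Finset (ι → L)) (i : ι) {q : ℝ} (hq0 : 0 ≤ q)
    (hq : ∀ u v, R u v →
      ((T.filter fun f => f i = u).card : ℝ) * (T.filter fun f => f i = v).card ≤ q) :
    (((T ×ˢ T).filter fun fg => R (fg.1 i) (fg.2 i)).card : ℝ) ≤ (Fintype.card L : ℝ) ^ 2 * q := by
  have h1 : ((T ×ˢ T).filter fun fg => R (fg.1 i) (fg.2 i)).card =
      ∑ w : L × L, (((T ×ˢ T).filter fun fg => R (fg.1 i) (fg.2 i)).filter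
        fun fg => (fg.1 i, fg.2 i) = w).card :=
    card_eq_sum_card_fiberwise fun _ _ => by simp
  have h2 : ∀ w : L × L, ((((T ×ˢ T).filter fun fg => R (fg.1 i) (fg.2 i)).filter
        fun fg => (fg.1 i, fg.2 i) = w).card : ℝ) ≤ q := by
    rintro ⟨u, v⟩
    by_cases huv : R u v
    · refine le_trans ?_ (hq u v huv)
      rw [← Nat.cast_mul, ← card_product, Nat.cast_le]
      refine card_le_card fun fg h => ?_
      simp only [mem_filter, mem_product, Prod.mk.injEq] at h ⊢
      exact ⟨⟨h.1.1.1, h.2.1⟩, h.1.1.2, h.2.2⟩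
    · rw [card_eq_zero.2]
      · simpa using hq0
      · refine filter_eq_empty_iff.2 fun fg h h' => huv ?_
        simp only [Prod.mk.injEq] at h'
        rw [← h'.1, ← h'.2]
        exact (mem_filter.1 h).2
  rw [h1, Nat.cast_sum]
  refine (sum_le_sum fun w _ => h2 w).trans ?_
  simp [sq]

/-- Double counting of related pairs over the coordinates, then pigeonhole over the level pairs,
makes a product of two fibre sizes large. As each factor is at most `|T|`, both are large. -/
theorem PairwiseSeparated.exists_large_fibers [Fintype ι] [Fintype L] {R : L → L → Prop} {κ : ℝ} (hκ : 0 < κ)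
    {T : Finset (ι → L)} (hT : PairwiseSeparated R κ T) (h2 : 2 ≤ T.card) :
    ∃ i u v, R u v ∧
      (T.card : ℝ) ≤ 4 * (Fintype.card L : ℝ) ^ 2 / κ * (T.filter fun f => f i = u).card ∧
      (T.card : ℝ) ≤ 4 * (Fintype.card L : ℝ) ^ 2 / κ * (T.filter fun f => f i = v).card := by
  obtain ⟨f₀, hf₀, g₀, hg₀, hne⟩ := one_lt_card.1 h2
  obtain ⟨i₀, -⟩ := Function.ne_iff.1 hne
  have hn : (0 : ℝ) < Fintype.card ι := by
    have := Fintype.card_pos_iff.2 ⟨i₀⟩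
    exact_mod_cast this
  have hb : (0 : ℝ) < Fintype.card L := by
    have := Fintype.card_pos_iff.2 ⟨f₀ i₀⟩
    exact_mod_cast this
  have hN : (2 : ℝ) ≤ T.card := by exact_mod_cast h2
  set N : ℝ := ((T.card : ℕ) : ℝ) with hNdef
  set b : ℝ := ((Fintype.card L : ℕ) : ℝ) with hbdef
  set n : ℝ := ((Fintype.card ι : ℕ) : ℝ) with hndef
  -- The `4` is `2 * 2`: `N^2 - N ≥ N^2 / 2` as `N ≥ 2`, and a pair may be related in either order.
  obtain ⟨i, u, v, huv, hprod⟩ : ∃ i u v, R u v ∧ κ * N ^ 2 / (4 * b ^ 2) ≤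
      ((T.filter fun f => f i = u).card : ℝ) * (T.filter fun f => f i = v).card := by
    by_contra! hcon
    -- the number of triples `(f, g, i)` with `R (f i) (g i)`
    have hswap : ∀ i, ((T ×ˢ T).filter fun fg => R (fg.2 i) (fg.1 i)).card =
        ((T ×ˢ T).filter fun fg => R (fg.1 i) (fg.2 i)).card := by
      intro i
      refine card_bij' (fun fg _ => fg.swap) (fun fg _ => fg.swap) ?_ ?_ ?_ ?_ <;>
        simp +contextual [and_comm]
    have hlow : (N ^ 2 - N) * (κ * n) ≤
        ∑ fg ∈ T.offDiag, ∑ i, if R (fg.1 i) (fg.2 i) ∨ R (fg.2 i) (fg.1 i) then (1 : ℝ) else 0 := by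
      have : (T.offDiag.card : ℝ) = N ^ 2 - N := by
        rw [offDiag_card, Nat.cast_sub (Nat.le_mul_self _)]
        push_cast; ring
      rw [← this, ← nsmul_eq_mul]
      refine card_nsmul_le_sum _ _ _ fun fg h => ?_
      rw [mem_offDiag] at h
      have := hT fg.1 h.1 fg.2 h.2.1 h.2.2
      rwa [← sum_boole] at this
    have hup : (∑ fg ∈ T.offDiag, ∑ i,
        if R (fg.1 i) (fg.2 i) ∨ R (fg.2 i) (fg.1 i) then (1 : ℝ) else 0) ≤
        ∑ i, 2 * (((T ×ˢ T).filter fun fg => R (fg.1 i) (fg.2 i)).card : ℝ) := by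
      rw [sum_comm]
      refine sum_le_sum fun i _ => ?_
      calc ∑ fg ∈ T.offDiag,
            (if R (fg.1 i) (fg.2 i) ∨ R (fg.2 i) (fg.1 i) then (1 : ℝ) else 0) ≤ ∑ fg ∈ T ×ˢ T,
            (if R (fg.1 i) (fg.2 i) ∨ R (fg.2 i) (fg.1 i) then (1 : ℝ) else 0) :=
            sum_le_sum_of_subset_of_nonneg (fun fg h => by
              rw [mem_offDiag] at h; exact mem_product.2 ⟨h.1, h.2.1⟩)
              fun _ _ _ => by split_ifs <;> simp
        _ ≤ ∑ fg ∈ T ×ˢ T, ((if R (fg.1 i) (fg.2 i) then (1 : ℝ) else 0) +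
              (if R (fg.2 i) (fg.1 i) then (1 : ℝ) else 0)) := by
            refine sum_le_sum fun fg _ => ?_
            by_cases h1 : R (fg.1 i) (fg.2 i) <;> by_cases h2 : R (fg.2 i) (fg.1 i) <;>
              simp [h1, h2]
        _ = 2 * (((T ×ˢ T).filter fun fg => R (fg.1 i) (fg.2 i)).card : ℝ) := by
            rw [sum_add_distrib, sum_boole, sum_boole, hswap i]; ring
    have hone : ∀ i, (((T ×ˢ T).filter fun fg => R (fg.1 i) (fg.2 i)).card : ℝ) <
        κ * N ^ 2 / 4 := by
      intro i
      have hNp : 0 < N := by linarith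
      -- a strict bound on finitely many products
      by_cases hex : ∃ u v, R u v
      · obtain ⟨⟨u₁, v₁⟩, hw₁, hmax⟩ := (univ.filter fun w : L × L => R w.1 w.2).exists_max_image
          (fun w => ((T.filter fun f => f i = w.1).card : ℝ) * (T.filter fun f => f i = w.2).card)
          (by obtain ⟨u, v, h⟩ := hex; exact ⟨(u, v), by simpa using h⟩)
        have hlt := hcon i u₁ v₁ (by simpa using hw₁)
        have := card_filter_rel_le R T i (q := ((T.filter fun f => f i = u₁).card : ℝ) *
          (T.filter fun f => f i = v₁).card) (by positivity)
          (fun u v h => hmax (u, v) (by simpa using h))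
        refine this.trans_lt ?_
        calc _ < b ^ 2 * (κ * N ^ 2 / (4 * b ^ 2)) := mul_lt_mul_of_pos_left hlt (by positivity)
          _ = _ := by field_simp
      · have := card_filter_rel_le R T i (q := 0) le_rfl
          (fun u v h => (hex ⟨u, v, h⟩).elim)
        refine this.trans_lt ?_
        rw [mul_zero]; positivity
    have hsum : ∑ i : ι, 2 * (((T ×ˢ T).filter fun fg => R (fg.1 i) (fg.2 i)).card : ℝ) <
        ∑ _i : ι, κ * N ^ 2 / 2 :=
      sum_lt_sum_of_nonempty ⟨i₀, mem_univ _⟩ fun i _ => by linarith [hone i]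
    have hfin : (N ^ 2 - N) * (κ * n) < n * (κ * N ^ 2 / 2) := by
      refine (hlow.trans hup).trans_lt (hsum.trans_eq ?_)
      simp [hndef]
    have : 0 ≤ (N * (N - 2)) * (κ * n) := by
      have : 0 ≤ N - 2 := by linarith
      positivity
    nlinarith
  have key : ∀ a b' : ℝ, 0 ≤ a → 0 ≤ b' → b' ≤ N → κ * N ^ 2 / (4 * b ^ 2) ≤ a * b' →
      N ≤ 4 * b ^ 2 / κ * a := by
    intro a b' ha hb' hle h
    have h1 : κ * N ^ 2 / (4 * b ^ 2) ≤ a * N := h.trans (mul_le_mul_of_nonneg_left hle ha)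
    have hNp : 0 < N := by linarith
    rw [div_le_iff₀ (by positivity)] at h1
    rw [div_mul_eq_mul_div, le_div_iff₀ hκ]
    have : N * (N * κ) ≤ N * (4 * b ^ 2 * a) := by nlinarith
    exact le_of_mul_le_mul_left this hNp
  refine ⟨i, u, v, huv, ?_, ?_⟩
  · exact key _ _ (by positivity) (by positivity)
      (Nat.cast_le.2 (card_le_card (filter_subset _ _))) hprod
  · exact key _ _ (by positivity) (by positivity)
      (Nat.cast_le.2 (card_le_card (filter_subset _ _)))
      (hprod.trans_eq (mul_comm _ _))

theorem PairwiseSeparated.mono [Fintype ι] {R : L → L → Prop} {κ : ℝ} {T T' : Finset (ι → L)}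
    (hT : PairwiseSeparated R κ T) (h : T' ⊆ T) : PairwiseSeparated R κ T' :=
  fun f hf g hg => hT f (h hf) g (h hg)

/-- Passing to the two large fibres divides the size by at most `M`, and their pattern counts add
up, so each step doubles the count. -/
theorem PairwiseSeparated.two_pow_le_card_shatteredPatterns [Fintype ι] [Fintype L] {R : L → L → Prop}
    (hR : ∀ u, ¬ R u u) {κ M : ℝ} (hκ : 0 < κ) (hM : 4 * (Fintype.card L : ℝ) ^ 2 / κ ≤ M)
    (hM2 : 2 ≤ M) (r : ℕ) {T : Finset (ι → L)} (hT : PairwiseSeparated R κ T)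
    (hr : M ^ r ≤ T.card) : 2 ^ r ≤ (shatteredPatterns R T).card := by
  induction r generalizing T with
  | zero =>
    have : 0 < T.card := by
      have : (0 : ℝ) < T.card := lt_of_lt_of_le (by simp) hr
      exact_mod_cast this
    obtain ⟨f, hf⟩ := card_pos.1 this
    rw [pow_zero, Nat.one_le_iff_ne_zero, ← Nat.pos_iff_ne_zero, card_pos]
    exact ⟨fun _ => none, mem_shatteredPatterns.2 ⟨by simp, fun _ => ⟨f, hf, by simp⟩⟩⟩
  | succ r ih =>
    have hMp : 0 < M := by linarith
    have h1 : (1 : ℝ) ≤ M ^ r := one_le_pow₀ (by linarith)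
    have h2 : 2 ≤ T.card := by
      have : (2 : ℝ) ≤ T.card := by
        refine le_trans ?_ hr
        rw [pow_succ]; nlinarith
      exact_mod_cast this
    obtain ⟨i, u, v, huv, hu, hv⟩ := hT.exists_large_fibers hκ h2
    have step : ∀ w, (T.card : ℝ) ≤ 4 * (Fintype.card L : ℝ) ^ 2 / κ *
        (T.filter fun f => f i = w).card →
        2 ^ r ≤ (shatteredPatterns R (T.filter fun f => f i = w)).card := by
      intro w hw
      refine ih (hT.mono (filter_subset _ _)) ?_
      have : M ^ r * M ≤ (T.filter fun f => f i = w).card * M := by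
        rw [← pow_succ, mul_comm _ M]
        exact hr.trans (hw.trans (mul_le_mul_of_nonneg_right hM (by positivity)))
      exact le_of_mul_le_mul_right this hMp
    have := card_shatteredPatterns_add_le hR T i huv
    have := step u hu
    have := step v hv
    rw [pow_succ]; omega

/-- The number of partial assignments with at most `d` assigned coordinates. -/
theorem card_patterns_le [Fintype ι] [Fintype L] (P : Finset (ι → Option L)) (d : ℕ)
    (hP : ∀ p ∈ P, (univ.filter fun i => p i ≠ none).card ≤ d) {t : ℝ} (ht : 0 < t) (ht1 : t ≤ 1) :
    (P.card : ℝ) * t ^ d ≤ (1 + t * Fintype.card L) ^ Fintype.card ι := by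
  -- Generating-function bound: an assigned coordinate has weight `t`, and the total weight of all
  -- assignments factors over coordinates.
  let c : Option L → ℝ := fun o => if o = none then 1 else t
  have hc : ∀ o, 0 ≤ c o := fun o => by simp only [c]; split_ifs <;> positivity
  have hw : ∀ p : ι → Option L, ∏ i, c (p i) =
      t ^ (univ.filter fun i => p i ≠ none).card := by
    intro p; simp only [c]; rw [prod_ite, prod_const, prod_const, one_pow, one_mul]
  have h1 : (P.card : ℝ) * t ^ d ≤ ∑ p ∈ P, ∏ i, c (p i) := by
    rw [← nsmul_eq_mul]
    refine card_nsmul_le_sum _ _ _ fun p hp => ?_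
    rw [hw]
    exact pow_le_pow_of_le_one ht.le ht1 (hP p hp)
  have h2 : ∑ p ∈ P, ∏ i, c (p i) ≤ ∑ p : ι → Option L, ∏ i, c (p i) :=
    sum_le_sum_of_subset_of_nonneg (subset_univ P) fun p _ _ => prod_nonneg fun i _ => hc (p i)
  have h3 : ∑ p : ι → Option L, ∏ i, c (p i) = (1 + t * Fintype.card L) ^ Fintype.card ι := by
    rw [← Fintype.prod_sum fun (_ : ι) o => c o, prod_const, Fintype.sum_option, card_univ]
    simp [c, mul_comm]
  exact h1.trans (h2.trans_eq h3)

end Combinatorics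

/-! ### From fat-shattering dimension to packing numbers. -/

section Packing

open Finset Classical

variable {S : Type*}

theorem FatShatters.card_le_of_fatDim_eq {C : Set (PConcept S)} {η : ℝ} {d : ℕ}
    (hd : fatDim C η = d) {s : Finset S} (hs : FatShatters C η s) : s.card ≤ d := by
  have : (s.card : ℕ∞) ≤ fatDim C η :=
    le_iSup₂ (f := fun (s : Finset S) (_ : s ∈ {s | FatShatters C η s}) => (s.card : ℕ∞)) s hs
  rw [hd] at this
  exact_mod_cast this

/-- Sample points may repeat, but not inside a shattered index set: raising `i` alone and then `j`
alone at a common point would order `a i` and `a j` both ways. -/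
theorem card_le_fatDim_of_indexed {C : Set (PConcept S)} {η : ℝ} (hη : 0 < η) {d : ℕ}
    (hd : fatDim C η = d) {ι : Type*} (x : ι → S) (J : Finset ι) (a : ι → ℝ)
    (h : ∀ B : Set ι, ∃ H ∈ C, ∀ i ∈ J,
      (i ∉ B → (H (x i) : ℝ) ≤ a i - η) ∧ (i ∈ B → a i + η ≤ (H (x i) : ℝ))) : J.card ≤ d := by
  rcases J.eq_empty_or_nonempty with rfl | ⟨i₀, hi₀⟩
  · simp
  have : Nonempty ι := ⟨i₀⟩
  have hinj : Set.InjOn x J := by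
    intro i hi j hj hij
    by_contra hne
    obtain ⟨H, -, hH⟩ := h {i}
    obtain ⟨H', -, hH'⟩ := h {j}
    have h1 := (hH i hi).2 rfl
    have h2 := (hH j hj).1 fun h => hne h.symm
    have h3 := (hH' j hj).2 rfl
    have h4 := (hH' i hi).1 fun h => hne h
    rw [hij] at h1 h4
    linarith
  rw [← card_image_of_injOn hinj]
  refine FatShatters.card_le_of_fatDim_eq hd ⟨fun y => a (Function.invFunOn x J y), ?_⟩
  intro B _
  obtain ⟨H, hHC, hH⟩ := h (x ⁻¹' B)
  refine ⟨H, hHC, fun y hy => ?_⟩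
  obtain ⟨i, hi, rfl⟩ := mem_image.1 hy
  dsimp only
  rw [hinj.leftInvOn_invFunOn hi]
  exact hH i hi

/-- The number of levels used to quantize `[0,1]` at width `η / 20`. -/
noncomputable def levelCount (η : ℝ) : ℕ := ⌊20 / η⌋₊ + 1

instance instNeZeroLevelCount (η : ℝ) : NeZero (levelCount η) := ⟨Nat.succ_ne_zero _⟩

/-- The quantization of `[0,1]` at width `η / 20`. -/
noncomputable def level (η : ℝ) (y : unitInterval) : Fin (levelCount η) :=
  Fin.ofNat _ ⌊(y : ℝ) * (20 / η)⌋₊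

theorem level_val {η : ℝ} (hη : 0 < η) (y : unitInterval) :
    (level η y : ℕ) = ⌊(y : ℝ) * (20 / η)⌋₊ := by
  have : ⌊(y : ℝ) * (20 / η)⌋₊ < levelCount η := by
    refine Nat.lt_succ_of_le (Nat.floor_le_floor ?_)
    exact mul_le_of_le_one_left (by positivity) y.2.2
  simp only [level, Fin.ofNat]
  exact Nat.mod_eq_of_lt this

theorem level_mul_le {η : ℝ} (hη : 0 < η) (y : unitInterval) :
    (level η y : ℝ) * (η / 20) ≤ y := by
  rw [level_val hη]
  have h0 : 0 ≤ (y : ℝ) * (20 / η) := mul_nonneg y.2.1 (by positivity)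
  have := Nat.floor_le h0
  calc _ ≤ (y : ℝ) * (20 / η) * (η / 20) := mul_le_mul_of_nonneg_right this (by positivity)
    _ = y := by field_simp

theorem lt_level_add_one_mul {η : ℝ} (hη : 0 < η) (y : unitInterval) :
    (y : ℝ) < ((level η y : ℝ) + 1) * (η / 20) := by
  rw [level_val hη]
  have := Nat.lt_floor_add_one ((y : ℝ) * (20 / η))
  calc (y : ℝ) = (y : ℝ) * (20 / η) * (η / 20) := by field_simp
    _ < _ := mul_lt_mul_of_pos_right this (by positivity)

/-- The first level is well below the second. -/
def LevelGap {η : ℝ} (u v : Fin (levelCount η)) : Prop := (u : ℕ) + 41 ≤ v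

theorem levelGap_of_le {η : ℝ} (hη : 0 < η) {y z : unitInterval}
    (h : (y : ℝ) + 21 / 10 * η ≤ z) : LevelGap (level η y) (level η z) := by
  have h1 := level_mul_le hη y
  have h2 := lt_level_add_one_mul hη z
  have : ((level η y : ℝ) + 41) * (η / 20) < ((level η z : ℝ) + 1) * (η / 20) := by linarith
  have := lt_of_mul_lt_mul_right this (by positivity)
  have : ((level η y : ℕ) + 41 : ℕ) < (level η z : ℕ) + 1 := by exact_mod_cast this
  unfold LevelGap; omega

/-- Differences are at most `1`, and at most `21 η / 10` where there is no level gap; exceeding a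
mean of `11 η / 5` therefore needs a gap on a fraction `η / 10` of the points. -/
theorem pairwiseSeparated_levels {η : ℝ} (hη : 0 < η) {ι : Type*} [Fintype ι] (x : ι → S)
    {T : Finset (PConcept S)}
    (hsep : ∀ H ∈ T, ∀ H' ∈ T, H ≠ H' →
      11 / 5 * η * Fintype.card ι < ∑ i, |(H (x i) : ℝ) - H' (x i)|) :
    PairwiseSeparated LevelGap (η / 10) (T.image fun H i => level η (H (x i))) := by
  intro f hf g hg hfg
  obtain ⟨H, hH, rfl⟩ := mem_image.1 hf
  obtain ⟨H', hH', rfl⟩ := mem_image.1 hg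
  have hs := hsep H hH H' hH' fun h => hfg (by rw [h])
  set A := univ.filter fun i => LevelGap (level η (H (x i))) (level η (H' (x i))) ∨
    LevelGap (level η (H' (x i))) (level η (H (x i))) with hA
  have hle : ∑ i, |(H (x i) : ℝ) - H' (x i)| ≤ ∑ i, ((if i ∈ A then 1 else 0) + 21 / 10 * η) := by
    refine sum_le_sum fun i _ => ?_
    split_ifs with hi
    · have : |(H (x i) : ℝ) - H' (x i)| ≤ 1 := by
        rw [abs_le]
        constructor <;> linarith [(H (x i)).2.1, (H (x i)).2.2, (H' (x i)).2.1, (H' (x i)).2.2]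
      have : 0 < 21 / 10 * η := by positivity
      linarith
    · rw [zero_add, abs_le]
      rw [hA, mem_filter] at hi
      push Not at hi
      have hi := hi (mem_univ i)
      constructor
      · by_contra hlt
        exact hi.1 (levelGap_of_le hη (by linarith))
      · by_contra hlt
        exact hi.2 (levelGap_of_le hη (by linarith))
  rw [sum_add_distrib, sum_boole, sum_const, nsmul_eq_mul, card_univ] at hle
  have hcard : (univ.filter fun i => i ∈ A) = A := by ext; simp
  rw [hcard] at hle
  linarith

theorem card_support_le_fatDim {C : Set (PConcept S)} {η : ℝ} (hη : 0 < η) {d : ℕ}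
    (hd : fatDim C η = d) {ι : Type*} [Fintype ι] (x : ι → S) {T : Finset (PConcept S)}
    (hTC : ∀ H ∈ T, H ∈ C)
    {p : ι → Option (Fin (levelCount η) × Fin (levelCount η))}
    (hp : p ∈ shatteredPatterns LevelGap (T.image fun H i => level η (H (x i)))) :
    (univ.filter fun i => p i ≠ none).card ≤ d := by
  rw [mem_shatteredPatterns] at hp
  refine card_le_fatDim_of_indexed hη hd x _
    -- The centre is `η` above the top of the lower cell. A gap of `41 = 1 + 40` levels puts the
    -- upper cell at least `2 η` above that top, so no scale is lost. The default `0` is never used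
    -- on the support.
    (fun i => (p i).elim 0 fun w => ((w.1 : ℝ) + 1) * (η / 20) + η) fun B => ?_
  obtain ⟨f, hf, h⟩ := hp.2 B
  obtain ⟨H, hH, rfl⟩ := mem_image.1 hf
  refine ⟨H, hTC H hH, fun i hi => ?_⟩
  obtain ⟨w, hw⟩ := Option.ne_none_iff_exists'.1 (mem_filter.1 hi).2
  simp only [hw, Option.elim_some]
  refine ⟨fun hB => ?_, fun hB => ?_⟩
  · have := lt_level_add_one_mul hη (H (x i))
    have e : level η (H (x i)) = w.1 := (h i w hw).2 hB
    rw [e] at this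
    linarith
  · have h1 := level_mul_le hη (H (x i))
    have e : level η (H (x i)) = w.2 := (h i w hw).1 hB
    rw [e] at h1
    have h2 : ((w.1 : ℝ) + 41) ≤ w.2 := by
      have : (w.1 : ℕ) + 41 ≤ w.2 := hp.1 i w hw
      exact_mod_cast this
    have h3 := mul_le_mul_of_nonneg_right h2 (show 0 ≤ η / 20 by positivity)
    linarith

/-- A class of fat-shattering dimension `d` at scale `η` has small packings, in the mean absolute
distance on `n` points, at separation `11 η / 5`. -/
theorem card_packing_lt {C : Set (PConcept S)} {η : ℝ} (hη : 0 < η) (hη1 : η ≤ 1) {d : ℕ}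
    (hd1 : 1 ≤ d) (hd : fatDim C η = d) {ι : Type*} [Fintype ι] (hdn : d ≤ Fintype.card ι)
    (x : ι → S) {T : Finset (PConcept S)} (hTC : ∀ H ∈ T, H ∈ C)
    (hsep : ∀ H ∈ T, ∀ H' ∈ T, H ≠ H' →
      11 / 5 * η * Fintype.card ι < ∑ i, |(H (x i) : ℝ) - H' (x i)|) {r : ℕ}
    (hr : (Real.exp 1 * (Fintype.card ι * (levelCount η : ℝ) ^ 2 / d)) ^ d < 2 ^ r) :
    (T.card : ℝ) < (40 * (levelCount η : ℝ) ^ 2 / η) ^ r := by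
  have hb1 : (1 : ℝ) ≤ levelCount η := by
    exact_mod_cast Nat.succ_le_succ (Nat.zero_le _)
  have hn : (0 : ℝ) < Fintype.card ι := by exact_mod_cast (by omega : 0 < Fintype.card ι)
  have hdr : (0 : ℝ) < d := by exact_mod_cast hd1
  have hdn' : (d : ℝ) ≤ Fintype.card ι := by exact_mod_cast hdn
  -- Equal levels everywhere force a mean distance of at most `η / 20`, so quantization merges no
  -- two members.
  have hinj : Set.InjOn (fun (H : PConcept S) i => level η (H (x i))) T := by
    intro H hH H' hH' heq
    by_contra hne
    refine absurd (hsep H hH H' hH' hne) (not_lt.2 ?_)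
    rw [← card_univ, mul_comm, ← nsmul_eq_mul]
    refine sum_le_card_nsmul _ _ _ fun i _ => ?_
    have heq : level η (H (x i)) = level η (H' (x i)) := congrFun heq i
    have h1 := level_mul_le hη (H (x i))
    have h2 := lt_level_add_one_mul hη (H (x i))
    have h3 := level_mul_le hη (H' (x i))
    have h4 := lt_level_add_one_mul hη (H' (x i))
    rw [← heq] at h3 h4
    rw [abs_le]; constructor <;> linarith
  by_contra hcon
  rw [not_lt, ← card_image_of_injOn hinj] at hcon
  have hM : 4 * (Fintype.card (Fin (levelCount η)) : ℝ) ^ 2 / (η / 10) ≤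
      40 * (levelCount η : ℝ) ^ 2 / η := by
    rw [Fintype.card_fin]
    apply le_of_eq; field_simp; norm_num
  have hM2 : 2 ≤ 40 * (levelCount η : ℝ) ^ 2 / η := by
    rw [le_div_iff₀ hη]; nlinarith
  have h1 := (pairwiseSeparated_levels hη x hsep).two_pow_le_card_shatteredPatterns
    (fun u h => by unfold LevelGap at h; omega) (by positivity) hM hM2 r hcon
  set P := shatteredPatterns LevelGap (T.image fun H i => level η (H (x i)))
  set n : ℝ := ((Fintype.card ι : ℕ) : ℝ)
  set b : ℝ := ((levelCount η : ℕ) : ℝ)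
  -- With this weight the generating function is `(1 + d / n)^n ≤ e^d`.
  have ht : 0 < (d : ℝ) / (n * b ^ 2) := by positivity
  have ht1 : (d : ℝ) / (n * b ^ 2) ≤ 1 := by
    rw [div_le_one (by positivity)]; nlinarith [mul_le_mul_of_nonneg_left (one_le_pow₀ hb1 : 1 ≤ b ^ 2) hn.le]
  have h2 := card_patterns_le P d (fun p hp => card_support_le_fatDim hη hd x hTC hp) ht ht1
  have h3 : (1 + (d : ℝ) / (n * b ^ 2) * (Fintype.card
      (Fin (levelCount η) × Fin (levelCount η)) : ℕ)) ^ Fintype.card ι ≤ Real.exp 1 ^ d := by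
    have : (d : ℝ) / (n * b ^ 2) * (Fintype.card
      (Fin (levelCount η) × Fin (levelCount η)) : ℕ) = d / n := by
      rw [Fintype.card_prod, Fintype.card_fin, Nat.cast_mul]
      change (d : ℝ) / (n * b ^ 2) * (b * b) = d / n
      field_simp
    rw [this, add_comm, ← Real.exp_nat_mul, mul_one]
    calc ((d : ℝ) / n + 1) ^ Fintype.card ι ≤ Real.exp (d / n) ^ Fintype.card ι :=
          pow_le_pow_left₀ (by positivity) (Real.add_one_le_exp _) _
      _ = Real.exp d := by
          rw [← Real.exp_nat_mul]; congr 1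
          change n * (d / n) = d
          field_simp
  have h4 : (P.card : ℝ) ≤ (Real.exp 1 * (n * b ^ 2 / d)) ^ d := by
    have h5 := h2.trans h3
    rw [mul_pow, ← inv_div, inv_pow, ← div_eq_mul_inv, le_div_iff₀ (by positivity)]
    exact h5
  have h5 : (2 : ℝ) ^ r ≤ P.card := by exact_mod_cast h1
  linarith

end Packing

/-! ### Random swaps of a double sample. -/

section Symmetrization

open Finset Classical

variable {S : Type*}

/-- The sign attached to a bit. -/
noncomputable def boolSign (b : Bool) : ℝ := if b then 1 else -1

/-- Hoeffding's inequality for Rademacher sums, in counting form. -/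
theorem card_rademacher_le {ι : Type*} [Fintype ι] (a : ι → ℝ) {A s : ℝ} (hA : 0 < A) (hs : 0 ≤ s)
    (hn : 0 < Fintype.card ι) (ha : ∀ i, |a i| ≤ A) :
    ((univ.filter fun σ : ι → Bool => s < ∑ i, boolSign (σ i) * a i).card : ℝ) ≤
      2 ^ Fintype.card ι * Real.exp (-s ^ 2 / (2 * A ^ 2 * Fintype.card ι)) := by
  have hn' : (0 : ℝ) < Fintype.card ι := by exact_mod_cast hn
  set n : ℝ := ((Fintype.card ι : ℕ) : ℝ) with hndef
  set l : ℝ := s / (A ^ 2 * n) with hl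
  have hl0 : 0 ≤ l := by positivity
  have h1 : ((univ.filter fun σ : ι → Bool => s < ∑ i, boolSign (σ i) * a i).card : ℝ) *
      Real.exp (l * s) ≤ ∑ σ : ι → Bool, ∏ i, Real.exp (l * (boolSign (σ i) * a i)) := by
    rw [← nsmul_eq_mul]
    refine (card_nsmul_le_sum _ (fun σ : ι → Bool => ∏ i, Real.exp (l * (boolSign (σ i) * a i))) _
      fun σ hσ => ?_).trans
      (sum_le_sum_of_subset_of_nonneg (subset_univ _) fun _ _ _ => by positivity)
    rw [← Real.exp_sum, ← mul_sum, Real.exp_le_exp]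
    exact mul_le_mul_of_nonneg_left (mem_filter.1 hσ).2.le hl0
  have h2 : ∑ σ : ι → Bool, ∏ i, Real.exp (l * (boolSign (σ i) * a i)) ≤
      2 ^ Fintype.card ι * Real.exp (n * (l ^ 2 * A ^ 2 / 2)) := by
    rw [← Fintype.prod_sum fun i (b : Bool) => Real.exp (l * (boolSign b * a i)), hndef,
      Real.exp_nat_mul, ← mul_pow, ← card_univ, ← prod_const]
    refine prod_le_prod (fun i _ => by positivity) fun i _ => ?_
    have h3 : ∑ b : Bool, Real.exp (l * (boolSign b * a i)) = 2 * Real.cosh (l * a i) := by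
      rw [Real.cosh_eq]; simp [boolSign]; ring
    have h4 : (l * a i) ^ 2 / 2 ≤ l ^ 2 * A ^ 2 / 2 := by
      have := sq_le_sq' (by linarith [neg_abs_le (a i), ha i]) ((le_abs_self _).trans (ha i))
      rw [mul_pow]
      nlinarith [mul_le_mul_of_nonneg_left this (sq_nonneg l)]
    rw [h3]
    have := (Real.cosh_le_exp_half_sq (l * a i)).trans (Real.exp_le_exp.2 h4)
    linarith
  have h5 : -s ^ 2 / (2 * A ^ 2 * n) = n * (l ^ 2 * A ^ 2 / 2) - l * s := by
    rw [hl]; field_simp; ring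
  rw [h5, Real.exp_sub, ← mul_div_assoc, le_div_iff₀ (Real.exp_pos _)]
  exact h1.trans h2

/-- A maximal separated set is a net. -/
theorem exists_net_of_packing_bound {X : Type*} (C : Set X) (dist : X → X → ℝ) {β N : ℝ}
    (hself : ∀ H, dist H H ≤ β) (hsymm : ∀ H H', dist H H' = dist H' H)
    (hN : ∀ T : Finset X, (∀ H ∈ T, H ∈ C) → (∀ H ∈ T, ∀ H' ∈ T, H ≠ H' → β < dist H H') →
      (T.card : ℝ) ≤ N) :
    ∃ T : Finset X, (∀ H ∈ T, H ∈ C) ∧ (T.card : ℝ) ≤ N ∧ ∀ H ∈ C, ∃ H' ∈ T, dist H H' ≤ β := by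
  let A : Set ℕ := {k | ∃ T : Finset X, T.card = k ∧ (∀ H ∈ T, H ∈ C) ∧
    ∀ H ∈ T, ∀ H' ∈ T, H ≠ H' → β < dist H H'}
  have hne : A.Nonempty := ⟨0, ∅, by simp⟩
  have hbdd : BddAbove A := by
    refine ⟨⌊N⌋₊, ?_⟩
    rintro k ⟨T, rfl, h1, h2⟩
    exact Nat.le_floor (hN T h1 h2)
  obtain ⟨T, hT, h1, h2⟩ := Nat.sSup_mem hne hbdd
  refine ⟨T, h1, hN T h1 h2, fun H hH => ?_⟩
  by_contra! hcon
  have hHT : H ∉ T := fun h => absurd (hcon H h) (not_lt.2 (hself H))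
  have : (insert H T).card ∈ A := by
    refine ⟨_, rfl, ?_, ?_⟩
    · intro G hG
      rcases mem_insert.1 hG with rfl | hG
      exacts [hH, h1 G hG]
    · intro G h G' h' hne
      rcases mem_insert.1 h with rfl | hG <;> rcases mem_insert.1 h' with rfl | hG'
      · exact absurd rfl hne
      · exact hcon G' hG'
      · rw [hsymm]; exact hcon G hG
      · exact h2 G hG G' hG' hne
  have := le_csSup hbdd this
  rw [card_insert_of_notMem hHT] at this
  omega

/-- The excess quadratic loss of `H` over `F` on a labelled example. -/
noncomputable def excessLoss (F H : PConcept S) (z : S × Bool) : ℝ :=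
  ((H z.1 : ℝ) - bitVal z.2) ^ 2 - ((F z.1 : ℝ) - bitVal z.2) ^ 2

theorem bitVal_mem (b : Bool) : 0 ≤ bitVal b ∧ bitVal b ≤ 1 := by
  cases b <;> simp [bitVal]

theorem abs_excessLoss_le (F H : PConcept S) (z : S × Bool) : |excessLoss F H z| ≤ 1 := by
  have key : ∀ u : unitInterval, 0 ≤ ((u : ℝ) - bitVal z.2) ^ 2 ∧
      ((u : ℝ) - bitVal z.2) ^ 2 ≤ 1 := by
    intro u
    refine ⟨sq_nonneg _, ?_⟩
    have := bitVal_mem z.2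
    rw [sq_le_one_iff_abs_le_one, abs_le]
    constructor <;> linarith [u.2.1, u.2.2]
  have h1 := key (H z.1)
  have h2 := key (F z.1)
  unfold excessLoss
  rw [abs_le]; constructor <;> linarith

/-- The difference of squares has the factor `H + H' - 2b`, which lies in `[-2, 2]`. -/
theorem abs_excessLoss_sub_le (F H H' : PConcept S) (z : S × Bool) :
    |excessLoss F H z - excessLoss F H' z| ≤ 2 * |(H z.1 : ℝ) - H' z.1| := by
  have : excessLoss F H z - excessLoss F H' z =
      ((H z.1 : ℝ) + H' z.1 - 2 * bitVal z.2) * ((H z.1 : ℝ) - H' z.1) := by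
    unfold excessLoss; ring
  rw [this, abs_mul]
  refine mul_le_mul_of_nonneg_right ?_ (abs_nonneg _)
  have := bitVal_mem z.2
  rw [abs_le]
  constructor <;> linarith [(H z.1).2.1, (H z.1).2.2, (H' z.1).2.1, (H' z.1).2.2]

/-- The double samples on which some member of `C` has a much larger excess loss on the second half
than on the first. -/
def deviationEvent {ι : Type*} [Fintype ι] (C : Set (PConcept S)) (F : PConcept S) (t : ℝ) :
    Set (ι ⊕ ι → S × Bool) :=
  {ζ | ∃ H ∈ C, t < ∑ i, (excessLoss F H (ζ (Sum.inr i)) - excessLoss F H (ζ (Sum.inl i)))}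

/-- The permutation exchanging the two copies of those `i` with `σ i = false`. -/
def swapPerm {ι : Type*} (σ : ι → Bool) : Equiv.Perm (ι ⊕ ι) where
  toFun := Sum.elim (fun i => if σ i then Sum.inl i else Sum.inr i)
    (fun i => if σ i then Sum.inr i else Sum.inl i)
  invFun := Sum.elim (fun i => if σ i then Sum.inl i else Sum.inr i)
    (fun i => if σ i then Sum.inr i else Sum.inl i)
  left_inv := by rintro (i | i) <;> cases h : σ i <;> simp [h]
  right_inv := by rintro (i | i) <;> cases h : σ i <;> simp [h]

theorem comp_swapPerm_mem_deviationEvent {ι : Type*} [Fintype ι] (C : Set (PConcept S))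
    (F : PConcept S) (t : ℝ) (σ : ι → Bool) (ζ : ι ⊕ ι → S × Bool) :
    ζ ∘ swapPerm σ ∈ deviationEvent C F t ↔ ∃ H ∈ C, t < ∑ i, boolSign (σ i) *
      (excessLoss F H (ζ (Sum.inr i)) - excessLoss F H (ζ (Sum.inl i))) := by
  have : ∀ H i, excessLoss F H ((ζ ∘ swapPerm σ) (Sum.inr i)) -
      excessLoss F H ((ζ ∘ swapPerm σ) (Sum.inl i)) = boolSign (σ i) *
      (excessLoss F H (ζ (Sum.inr i)) - excessLoss F H (ζ (Sum.inl i))) := by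
    intro H i
    cases h : σ i <;> simp [swapPerm, boolSign, h]
  simp only [deviationEvent, Set.mem_ofPred_eq, this]

/-- The empirical distance on the whole double sample does not see swaps, so one net serves every
`σ`. Moving to the net costs `2 * (11/5) * 2 = 44/5` out of `9` (in units of `η n`), and Hoeffding
with increments bounded by `2` at the remaining `1/5` gives the exponent `η^2 n / 200`. -/
theorem card_swaps_mem_deviationEvent_le {ι : Type*} [Fintype ι] (hn : 0 < Fintype.card ι)
    (C : Set (PConcept S)) (F : PConcept S) {η N : ℝ} (hη : 0 < η) (ζ : ι ⊕ ι → S × Bool)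
    (hN : ∀ T : Finset (PConcept S), (∀ H ∈ T, H ∈ C) → (∀ H ∈ T, ∀ H' ∈ T, H ≠ H' →
      11 / 5 * η * Fintype.card (ι ⊕ ι) < ∑ i, |(H (ζ i).1 : ℝ) - H' (ζ i).1|) →
      (T.card : ℝ) ≤ N) :
    ((univ.filter fun σ : ι → Bool =>
      ζ ∘ swapPerm σ ∈ deviationEvent C F (9 * η * Fintype.card ι)).card : ℝ) ≤
      N * (2 ^ Fintype.card ι * Real.exp (-η ^ 2 * Fintype.card ι / 200)) := by
  have hn' : (0 : ℝ) < Fintype.card ι := by exact_mod_cast hn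
  obtain ⟨T, -, hTN, hnet⟩ := exists_net_of_packing_bound C
    (fun H H' => ∑ i, |(H (ζ i).1 : ℝ) - H' (ζ i).1|) (β := 11 / 5 * η * Fintype.card (ι ⊕ ι))
    (fun H => by simp; positivity) (fun H H' => by simp only [abs_sub_comm]) hN
  let D : PConcept S → ι → ℝ := fun H i =>
    excessLoss F H (ζ (Sum.inr i)) - excessLoss F H (ζ (Sum.inl i))
  have hsub : (univ.filter fun σ : ι → Bool =>
      ζ ∘ swapPerm σ ∈ deviationEvent C F (9 * η * Fintype.card ι)) ⊆
      T.biUnion fun H => univ.filter fun σ : ι → Bool =>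
        η * Fintype.card ι / 5 < ∑ i, boolSign (σ i) * D H i := by
    intro σ hσ
    obtain ⟨H, hH, hlt⟩ := (comp_swapPerm_mem_deviationEvent C F _ σ ζ).1 (mem_filter.1 hσ).2
    obtain ⟨H', hH', hd⟩ := hnet H hH
    refine mem_biUnion.2 ⟨H', hH', mem_filter.2 ⟨mem_univ _, ?_⟩⟩
    have hdiff : ∑ i, boolSign (σ i) * D H i - ∑ i, boolSign (σ i) * D H' i ≤
        2 * ∑ i, |(H (ζ i).1 : ℝ) - H' (ζ i).1| := by
      rw [← sum_sub_distrib, Fintype.sum_sum_type, ← sum_add_distrib, mul_sum]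
      refine sum_le_sum fun i _ => ?_
      have h1 := abs_le.1 (abs_excessLoss_sub_le F H H' (ζ (Sum.inr i)))
      have h2 := abs_le.1 (abs_excessLoss_sub_le F H H' (ζ (Sum.inl i)))
      cases σ i <;> simp only [boolSign, D] <;> norm_num <;> linarith
    rw [Fintype.card_sum, Nat.cast_add] at hd
    have hlt : 9 * η * Fintype.card ι < ∑ i, boolSign (σ i) * D H i := hlt
    linarith
  have hbound : ∀ H ∈ T, ((univ.filter fun σ : ι → Bool =>
        η * Fintype.card ι / 5 < ∑ i, boolSign (σ i) * D H i).card : ℝ) ≤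
      2 ^ Fintype.card ι * Real.exp (-η ^ 2 * Fintype.card ι / 200) := by
    intro H _
    refine (card_rademacher_le (D H) two_pos (by positivity) hn fun i => ?_).trans_eq ?_
    · have h1 := abs_le.1 (abs_excessLoss_le F H (ζ (Sum.inr i)))
      have h2 := abs_le.1 (abs_excessLoss_le F H (ζ (Sum.inl i)))
      rw [abs_le]; constructor <;> simp only [D] <;> linarith
    · congr 2
      field_simp; norm_num
  calc _ ≤ (((T.biUnion fun H => univ.filter fun σ : ι → Bool =>
        η * Fintype.card ι / 5 < ∑ i, boolSign (σ i) * D H i).card : ℕ) : ℝ) :=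
        Nat.cast_le.2 (card_le_card hsub)
    _ ≤ ∑ H ∈ T, ((univ.filter fun σ : ι → Bool =>
        η * Fintype.card ι / 5 < ∑ i, boolSign (σ i) * D H i).card : ℝ) := by
        exact_mod_cast card_biUnion_le
    _ ≤ T.card * (2 ^ Fintype.card ι * Real.exp (-η ^ 2 * Fintype.card ι / 200)) := by
        rw [← nsmul_eq_mul]; exact sum_le_card_nsmul _ _ _ hbound
    _ ≤ _ := mul_le_mul_of_nonneg_right hTN (by positivity)

end Symmetrization

/-! ### Labelled samples, measurability and the ghost sample. -/

section Sampling

open Classical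

variable {S : Type*} [MeasurableSpace S]

theorem measurePreserving_fst_labelledLaw (D : Measure S) {F : PConcept S} (hF : Measurable F) :
    MeasurePreserving Prod.fst (labelledLaw D F) D := by
  refine ⟨measurable_fst, ?_⟩
  have hFr : Measurable fun x => (F x : ℝ) := measurable_subtype_coe.comp hF
  have hm : ∀ b : Bool, Measurable fun x : S => (x, b) := fun b => measurable_id.prodMk measurable_const
  unfold labelledLaw
  rw [Measure.map_add _ _ measurable_fst, Measure.map_map measurable_fst (hm _),
    Measure.map_map measurable_fst (hm _)]
  have hid : ∀ b : Bool, (Prod.fst ∘ fun x : S => (x, b)) = id := fun b => rfl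
  rw [hid, hid, Measure.map_id, Measure.map_id, ← withDensity_add_left hFr.ennreal_ofReal]
  have : ((fun x => ENNReal.ofReal (F x : ℝ)) + fun x => ENNReal.ofReal (1 - F x)) = 1 := by
    funext x
    rw [Pi.add_apply, ← ENNReal.ofReal_add (F x).2.1 (by linarith [(F x).2.2])]
    simp
  rw [this, withDensity_one]

theorem isProbabilityMeasure_labelledLaw (D : Measure S) [IsProbabilityMeasure D]
    {F : PConcept S} (hF : Measurable F) : IsProbabilityMeasure (labelledLaw D F) := by
  constructor
  have := (measurePreserving_fst_labelledLaw D hF).measure_preimage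
    (MeasurableSet.univ (α := S)).nullMeasurableSet
  simpa using this

theorem integral_labelledLaw (D : Measure S) [IsProbabilityMeasure D]
    {F : PConcept S} (hF : Measurable F) {g : S × Bool → ℝ} (hg : Measurable g)
    {c : ℝ} (hc : ∀ z, |g z| ≤ c) :
    ∫ z, g z ∂(labelledLaw D F) =
      ∫ x, ((F x : ℝ) * g (x, true) + (1 - (F x : ℝ)) * g (x, false)) ∂D := by
  have hFr : Measurable fun x => (F x : ℝ) := measurable_subtype_coe.comp hF
  have hm : ∀ b : Bool, Measurable fun x : S => (x, b) := fun b => measurable_id.prodMk measurable_const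
  have := isProbabilityMeasure_labelledLaw D hF
  have hint : Integrable g (labelledLaw D F) :=
    Integrable.of_bound hg.aestronglyMeasurable c (ae_of_all _ hc)
  have hgm : ∀ b, Measurable fun x => g (x, b) := fun b => hg.comp (hm b)
  have hint' : ∀ b, Integrable (fun x => g (x, b)) D := fun b =>
    Integrable.of_bound (hgm b).aestronglyMeasurable c (ae_of_all _ fun x => hc _)
  have hdens : ∀ (p : S → ℝ), Measurable p → (∀ x, 0 ≤ p x) → ∀ b,
      ∫ z, g z ∂((D.withDensity fun x => ENNReal.ofReal (p x)).map fun x => (x, b)) =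
        ∫ x, p x * g (x, b) ∂D := by
    intro p hp hp0 b
    rw [integral_map (hm b).aemeasurable hg.aestronglyMeasurable,
      integral_withDensity_eq_integral_toReal_smul hp.ennreal_ofReal
        (ae_of_all _ fun x => ENNReal.ofReal_lt_top)]
    refine integral_congr_ae (ae_of_all _ fun x => ?_)
    simp [ENNReal.toReal_ofReal (hp0 x)]
  unfold labelledLaw at hint ⊢
  rw [integral_add_measure hint.left_of_add_measure hint.right_of_add_measure,
    hdens _ hFr (fun x => (F x).2.1),
    hdens (fun x => 1 - (F x : ℝ)) (measurable_const.sub hFr) (fun x => sub_nonneg.2 (F x).2.2),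
    ← integral_add]
  · exact (hint' true).bdd_mul hFr.aestronglyMeasurable (c := 1)
      (ae_of_all _ fun x => by rw [Real.norm_eq_abs, abs_of_nonneg (F x).2.1]; exact (F x).2.2)
  · exact (hint' false).bdd_mul (measurable_const.sub hFr).aestronglyMeasurable (c := 1)
      (ae_of_all _ fun x => by
        rw [Real.norm_eq_abs, abs_of_nonneg (sub_nonneg.2 (F x).2.2)]; linarith [(F x).2.1])

theorem measurable_bitVal : Measurable bitVal := measurable_from_top

theorem measurable_excessLoss {F H : PConcept S} (hF : Measurable F) (hH : Measurable H) :
    Measurable (excessLoss F H) := by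
  have hFr : Measurable fun z : S × Bool => (F z.1 : ℝ) :=
    measurable_subtype_coe.comp (hF.comp measurable_fst)
  have hHr : Measurable fun z : S × Bool => (H z.1 : ℝ) :=
    measurable_subtype_coe.comp (hH.comp measurable_fst)
  have hb : Measurable fun z : S × Bool => bitVal z.2 := measurable_bitVal.comp measurable_snd
  unfold excessLoss
  exact ((hHr.sub hb).pow_const 2).sub ((hFr.sub hb).pow_const 2)

/-- Averaging over a label of mean `F x` leaves `(H x - F x)^2` pointwise. -/
theorem integral_excessLoss (D : Measure S) [IsProbabilityMeasure D] {F H : PConcept S}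
    (hF : Measurable F) (hH : Measurable H) :
    ∫ z, excessLoss F H z ∂(labelledLaw D F) = ∫ x, ((H x : ℝ) - F x) ^ 2 ∂D := by
  rw [integral_labelledLaw D hF (measurable_excessLoss hF hH) (abs_excessLoss_le F H)]
  refine integral_congr_ae (ae_of_all _ fun x => ?_)
  simp only [excessLoss, bitVal]
  norm_num
  ring

theorem measurePreserving_comp_equiv {X : Type*} [MeasurableSpace X] (μ : Measure X)
    [SigmaFinite μ] {κ κ' : Type*} [Fintype κ] [Fintype κ'] (e : κ ≃ κ') :
    MeasurePreserving (fun x : κ' → X => x ∘ e) (Measure.pi fun _ => μ) (Measure.pi fun _ => μ) := by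
  have hm : Measurable fun x : κ' → X => x ∘ e :=
    measurable_pi_iff.2 fun i => measurable_pi_apply (e i)
  refine ⟨hm, (Measure.pi_eq fun s hs => ?_).symm⟩
  rw [Measure.map_apply hm (MeasurableSet.univ_pi hs)]
  have : (fun x : κ' → X => x ∘ e) ⁻¹' Set.univ.pi s = Set.univ.pi (s ∘ e.symm) := by
    ext x
    simp only [Set.mem_preimage, Set.mem_univ_pi, Function.comp]
    exact ⟨fun h i => by simpa using h (e.symm i), fun h i => by simpa using h (e i)⟩
  rw [this, Measure.pi_pi]
  exact Equiv.prod_comp e.symm fun i => μ (s i)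

theorem MeasurableClass.nullMeasurableSet_hit {C : Set (PConcept S)} {D : Measure S}
    [IsProbabilityMeasure D] (hC : MeasurableClass C D) {κ : Type*} [Fintype κ]
    {U : Set (κ → unitInterval)} (hU : IsOpen U) :
    NullMeasurableSet {x : κ → S | ∃ H ∈ C, (fun i => H (x i)) ∈ U} (Measure.pi fun _ => D) := by
  let e := (Fintype.equivFin κ).symm
  have hV : IsOpen ((fun w : Fin (Fintype.card κ) → unitInterval => w ∘ e.symm) ⁻¹' U) :=
    hU.preimage (continuous_pi fun i => continuous_apply (e.symm i))
  have := (hC.nullMeasurable_hit _ _ hV).preimage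
    (measurePreserving_comp_equiv D e).quasiMeasurePreserving
  convert this using 1
  ext x
  simp [Function.comp_def]

/-- The difference of the quadratic losses of the values `u` on the two halves of a double sample
with labels `b`. -/
noncomputable def lossDiff {ι : Type*} [Fintype ι] (b : ι ⊕ ι → Bool) (u : ι ⊕ ι → unitInterval) :
    ℝ :=
  ∑ i, (((u (Sum.inr i) : ℝ) - bitVal (b (Sum.inr i))) ^ 2 -
    ((u (Sum.inl i) : ℝ) - bitVal (b (Sum.inl i))) ^ 2)

theorem continuous_lossDiff {ι : Type*} [Fintype ι] (b : ι ⊕ ι → Bool) :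
    Continuous (lossDiff b) := by
  unfold lossDiff
  fun_prop

/-- The measurability convention concerns the points only and does not involve `F`. Fixing the
finitely many label vectors, and separating the `H`-part from the `F`-part by a rational, reduces to
countably many open hitting events. -/
theorem nullMeasurableSet_deviationEvent {ι : Type*} [Fintype ι] {C : Set (PConcept S)}
    {D : Measure S} [IsProbabilityMeasure D] (hC : MeasurableClass C D) {F : PConcept S}
    (hF : Measurable F) (t : ℝ) :
    NullMeasurableSet (deviationEvent (ι := ι) C F t) (Measure.pi fun _ => labelledLaw D F) := by
  have := isProbabilityMeasure_labelledLaw D hF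
  let pts : (ι ⊕ ι → S × Bool) → (ι ⊕ ι → S) := fun ζ i => (ζ i).1
  have hpts : MeasurePreserving pts (Measure.pi fun _ => labelledLaw D F) (Measure.pi fun _ => D) :=
    measurePreserving_pi _ _ fun _ => measurePreserving_fst_labelledLaw D hF
  have hdec : deviationEvent (ι := ι) C F t = ⋃ (b : ι ⊕ ι → Bool), ⋃ (q : ℚ),
      ({ζ | (fun i => (ζ i).2) = b} ∩ pts ⁻¹' {x | t + lossDiff b (fun i => F (x i)) ≤ q}) ∩
        pts ⁻¹' {x | ∃ H ∈ C, (fun i => H (x i)) ∈ {u | (q : ℝ) < lossDiff b u}} := by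
    ext ζ
    have hsum : ∀ H : PConcept S,
        ∑ i, (excessLoss F H (ζ (Sum.inr i)) - excessLoss F H (ζ (Sum.inl i))) =
        lossDiff (fun i => (ζ i).2) (fun i => H (pts ζ i)) -
          lossDiff (fun i => (ζ i).2) (fun i => F (pts ζ i)) := by
      intro H
      unfold lossDiff
      rw [← Finset.sum_sub_distrib]
      refine Finset.sum_congr rfl fun i _ => ?_
      simp only [excessLoss, pts]; ring
    simp only [deviationEvent, hsum, Set.mem_iUnion, Set.mem_inter_iff, Set.mem_preimage,
      Set.mem_ofPred_eq]
    constructor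
    · rintro ⟨H, hH, hlt⟩
      obtain ⟨q, hq1, hq2⟩ := exists_rat_btwn (lt_sub_iff_add_lt.1 hlt)
      exact ⟨_, q, ⟨rfl, hq1.le⟩, H, hH, hq2⟩
    · rintro ⟨b, q, ⟨rfl, hq⟩, H, hH, hlt⟩
      exact ⟨H, hH, by linarith⟩
  rw [hdec]
  refine NullMeasurableSet.iUnion fun b => NullMeasurableSet.iUnion fun q => ?_
  refine NullMeasurableSet.inter (MeasurableSet.nullMeasurableSet (MeasurableSet.inter ?_ ?_)) ?_
  · have : Measurable fun (ζ : ι ⊕ ι → S × Bool) i => (ζ i).2 := by fun_prop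
    exact this (measurableSet_singleton b)
  · refine hpts.measurable ?_
    have h1 : Measurable fun (x : ι ⊕ ι → S) i => F (x i) :=
      measurable_pi_iff.2 fun i => hF.comp (measurable_pi_apply i)
    exact measurableSet_le (measurable_const.add ((continuous_lossDiff b).measurable.comp h1))
      measurable_const
  · exact (hC.nullMeasurableSet_hit (isOpen_lt continuous_const (continuous_lossDiff b))).preimage
      hpts.quasiMeasurePreserving

/-- An event has small probability if every point has few random swaps in it. -/
theorem measure_le_of_card_swaps_le {Z : Type*} [MeasurableSpace Z] (P : Measure Z)
    [IsProbabilityMeasure P] {ι : Type*} [Fintype ι] {B : Set (ι ⊕ ι → Z)}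
    (hB : NullMeasurableSet B (Measure.pi fun _ => P)) {c : ℝ}
    (h : ∀ ζ : ι ⊕ ι → Z, ((Finset.univ.filter fun σ : ι → Bool => ζ ∘ swapPerm σ ∈ B).card : ℝ) ≤
      2 ^ Fintype.card ι * c) :
    Measure.pi (fun _ => P) B ≤ ENNReal.ofReal c := by
  set ν : Measure (ι ⊕ ι → Z) := Measure.pi fun _ => P
  have hmp : ∀ σ : ι → Bool, MeasurePreserving (fun ζ : ι ⊕ ι → Z => ζ ∘ swapPerm σ) ν ν :=
    fun σ => measurePreserving_comp_equiv P (swapPerm σ)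
  have hnull : ∀ σ : ι → Bool,
      NullMeasurableSet ((fun ζ : ι ⊕ ι → Z => ζ ∘ swapPerm σ) ⁻¹' B) ν :=
    fun σ => hB.preimage (hmp σ).quasiMeasurePreserving
  have h1 : (2 : ENNReal) ^ Fintype.card ι * ν B ≤ 2 ^ Fintype.card ι * ENNReal.ofReal c := by
    -- Each swap preserves the product measure, so `ν B` is the mean over `σ` of the measures of the
    -- swapped events.
    calc (2 : ENNReal) ^ Fintype.card ι * ν B
        = ∑ σ : ι → Bool, ν ((fun ζ : ι ⊕ ι → Z => ζ ∘ swapPerm σ) ⁻¹' B) := by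
          rw [Finset.sum_congr rfl fun σ _ => (hmp σ).measure_preimage hB]
          simp
      _ = ∑ σ : ι → Bool, ∫⁻ ζ, ((fun ζ : ι ⊕ ι → Z => ζ ∘ swapPerm σ) ⁻¹' B).indicator 1 ζ ∂ν :=
          Finset.sum_congr rfl fun σ _ => (lintegral_indicator_one₀ (hnull σ)).symm
      _ = ∫⁻ ζ, ∑ σ : ι → Bool, ((fun ζ : ι ⊕ ι → Z => ζ ∘ swapPerm σ) ⁻¹' B).indicator 1 ζ ∂ν := by
          rw [lintegral_finsetSum']
          exact fun σ _ => aemeasurable_one.indicator₀ (hnull σ)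
      _ ≤ ∫⁻ _, 2 ^ Fintype.card ι * ENNReal.ofReal c ∂ν := by
          refine lintegral_mono fun ζ => ?_
          have h2 : ∑ σ : ι → Bool,
              ((fun ζ : ι ⊕ ι → Z => ζ ∘ swapPerm σ) ⁻¹' B).indicator (1 : (ι ⊕ ι → Z) → ENNReal) ζ =
              ((Finset.univ.filter fun σ : ι → Bool => ζ ∘ swapPerm σ ∈ B).card : ENNReal) := by
            rw [← Finset.sum_boole]
            refine Finset.sum_congr rfl fun σ _ => ?_
            simp [Set.indicator_apply]
          rw [h2, ← ENNReal.ofReal_natCast]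
          refine (ENNReal.ofReal_le_ofReal (h ζ)).trans_eq ?_
          rw [ENNReal.ofReal_mul (by positivity), ENNReal.ofReal_pow (by norm_num)]
          simp
      _ = _ := by simp
  exact (ENNReal.mul_le_mul_iff_right (by positivity) (by finiteness)).1 h1

/-- If every point of `A` extends to `B` with probability at least one half, then up to a factor
`2` the outer probability of `A` is at most that of `B`. -/
theorem exists_measurableSet_of_ghost_sample {Z : Type*} [MeasurableSpace Z] (P : Measure Z)
    [IsProbabilityMeasure P] {ι : Type*} [Fintype ι] (A : Set (ι → Z)) (B : Set (ι ⊕ ι → Z))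
    (h : ∀ z ∈ A, 1 / 2 ≤ Measure.pi (fun _ => P) {z' : ι → Z | Sum.elim z z' ∈ B}) :
    ∃ A' : Set (ι → Z), MeasurableSet A' ∧ A ⊆ A' ∧
      Measure.pi (fun _ => P) A' ≤ 2 * Measure.pi (fun _ => P) B := by
  set μ : Measure (ι → Z) := Measure.pi fun _ => P
  set ν : Measure (ι ⊕ ι → Z) := Measure.pi fun _ => P
  have hmp : MeasurePreserving (MeasurableEquiv.sumPiEquivProdPi fun _ : ι ⊕ ι => Z).symm
    (μ.prod μ) ν := measurePreserving_sumPiEquivProdPi_symm fun _ => P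
  -- Replacing `B` by a measurable hull makes sections measurable, so `A` needs no measurability;
  -- Markov's inequality for the section measures then yields the factor `2`.
  set E := (MeasurableEquiv.sumPiEquivProdPi fun _ : ι ⊕ ι => Z).symm ⁻¹' toMeasurable ν B
  have hE : MeasurableSet E := hmp.measurable (measurableSet_toMeasurable _ _)
  have hEm : (μ.prod μ) E = ν B := by
    rw [hmp.measure_preimage (measurableSet_toMeasurable _ _).nullMeasurableSet,
      measure_toMeasurable]
  have hsec : Measurable fun z => μ (Prod.mk z ⁻¹' E) := measurable_measure_prodMk_left hE
  refine ⟨{z | 1 / 2 ≤ μ (Prod.mk z ⁻¹' E)}, measurableSet_le measurable_const hsec, ?_, ?_⟩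
  · intro z hz
    refine (h z hz).trans (measure_mono fun z' hz' => ?_)
    have : (MeasurableEquiv.sumPiEquivProdPi fun _ : ι ⊕ ι => Z).symm (z, z') = Sum.elim z z' := by
      funext i; cases i <;> rfl
    change (MeasurableEquiv.sumPiEquivProdPi fun _ : ι ⊕ ι => Z).symm (z, z') ∈ toMeasurable ν B
    rw [this]
    exact subset_toMeasurable ν B hz'
  · have := mul_meas_ge_le_lintegral (μ := μ) hsec (1 / 2)
    rw [← Measure.prod_apply hE, hEm] at this
    calc _ = 2 * (1 / 2 * μ {z | 1 / 2 ≤ μ (Prod.mk z ⁻¹' E)}) := by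
          rw [← mul_assoc, one_div, ENNReal.mul_inv_cancel two_ne_zero ENNReal.ofNat_ne_top, one_mul]
      _ ≤ _ := by gcongr

/-- Chebyshev: the variance of the sum is at most `n`, and failure means falling `η n` below the
mean, which has probability at most `1 / (η^2 n) ≤ 1/2`. -/
theorem half_le_measure_sum_gt {Z : Type*} [MeasurableSpace Z] (P : Measure Z)
    [IsProbabilityMeasure P] {ι : Type*} [Fintype ι] {g : Z → ℝ} (hg : Measurable g)
    (hg1 : ∀ z, |g z| ≤ 1) {η : ℝ} (hη : 0 < η) (hI : 10 * η < ∫ z, g z ∂P)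
    (hn : 2 ≤ η ^ 2 * Fintype.card ι) :
    1 / 2 ≤ Measure.pi (fun _ => P) {z : ι → Z | 9 * η * Fintype.card ι < ∑ i, g (z i)} := by
  set μ : Measure (ι → Z) := Measure.pi fun _ => P
  have hn' : (0 : ℝ) < Fintype.card ι := by
    by_contra hcon
    have := mul_nonpos_of_nonneg_of_nonpos (sq_nonneg η) (not_lt.1 hcon)
    linarith
  have hmem : MemLp g 2 P := MemLp.of_bound hg.aestronglyMeasurable 1 (ae_of_all _ hg1)
  let X : (ι → Z) → ℝ := ∑ i, fun z => g (z i)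
  have hXapp : ∀ z, X z = ∑ i, g (z i) := fun z => by simp [X]
  have hmemi : ∀ i, MemLp (fun z : ι → Z => g (z i)) 2 μ := fun i =>
    hmem.comp_measurePreserving (measurePreserving_eval (fun _ => P) i)
  have hX : MemLp X 2 μ := memLp_finsetSum' _ fun i _ => hmemi i
  have hvar : ProbabilityTheory.variance X μ ≤ Fintype.card ι := by
    rw [ProbabilityTheory.variance_sum_pi (fun _ => hmem), Finset.sum_const, nsmul_eq_mul,
      Finset.card_univ]
    have := ProbabilityTheory.variance_le_sq_of_bounded (μ := P) (X := g) (a := -1) (b := 1)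
      (ae_of_all _ fun z => abs_le.1 (hg1 z)) hg.aemeasurable
    norm_num at this
    nlinarith
  have hmean : ∫ z, X z ∂μ = Fintype.card ι * ∫ z, g z ∂P := by
    simp only [hXapp]
    rw [integral_finsetSum _ fun i _ => (hmemi i).integrable (by norm_num)]
    have : ∀ i, ∫ z : ι → Z, g (z i) ∂μ = ∫ z, g z ∂P := fun i =>
      integral_comp_eval (μ := fun _ : ι => P) hg.aestronglyMeasurable
    simp [this]
  have hcheb := ProbabilityTheory.meas_ge_le_variance_div_sq hX
    (c := η * Fintype.card ι) (by positivity)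
  have hsmall : μ {z | 9 * η * Fintype.card ι < ∑ i, g (z i)}ᶜ ≤ 1 / 2 := by
    calc _ ≤ μ {z | η * Fintype.card ι ≤ |X z - ∫ z, X z ∂μ|} := by
          refine measure_mono fun z hz => ?_
          have hz : ∑ i, g (z i) ≤ 9 * η * Fintype.card ι := not_lt.1 hz
          change η * Fintype.card ι ≤ |X z - ∫ z, X z ∂μ|
          rw [hXapp, hmean, abs_sub_comm]
          refine le_trans ?_ (le_abs_self _)
          nlinarith
      _ ≤ _ := hcheb
      _ ≤ ENNReal.ofReal (1 / 2) := by
          refine ENNReal.ofReal_le_ofReal ?_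
          rw [div_le_iff₀ (by positivity)]
          nlinarith
      _ = 1 / 2 := by
          rw [ENNReal.ofReal_div_of_pos two_pos]; simp
  have hmeas : MeasurableSet {z : ι → Z | 9 * η * Fintype.card ι < ∑ i, g (z i)} :=
    measurableSet_lt measurable_const
      (Finset.measurable_sum _ fun i _ => hg.comp (measurable_pi_apply i))
  have hadd := prob_add_prob_compl (μ := μ) hmeas
  have : (1 : ENNReal) - 1 / 2 ≤ μ {z : ι → Z | 9 * η * Fintype.card ι < ∑ i, g (z i)} := by
    exact tsub_le_iff_right.2 (hadd.symm.le.trans (add_le_add_right hsmall _))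
  simpa using this

/-- The good event is the complement of a measurable set covering the samples on which some `H` far
from `F` does at least as well as `F`. A minimizer always does at least as well, since `F` lies in
`C`. -/
theorem exists_good_event {m : ℕ} {C : Set (PConcept S)}
    {D : Measure S} [IsProbabilityMeasure D] (hC : MeasurableClass C D) {F : PConcept S}
    (hFC : F ∈ C) {η N : ℝ} (hη : 0 < η) (hm : 2 ≤ η ^ 2 * m)
    (hN : ∀ (x : Fin m ⊕ Fin m → S) (T : Finset (PConcept S)), (∀ H ∈ T, H ∈ C) →
      (∀ H ∈ T, ∀ H' ∈ T, H ≠ H' →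
        11 / 5 * η * Fintype.card (Fin m ⊕ Fin m) < ∑ i, |(H (x i) : ℝ) - H' (x i)|) →
      (T.card : ℝ) ≤ N) :
    ∃ G : Set (Fin m → S × Bool), MeasurableSet G ∧
      1 - 2 * (N * Real.exp (-η ^ 2 * m / 200)) ≤ (sampleLaw D F m).real G ∧
      ∀ z ∈ G, ∀ H ∈ C, IsMinOn (quadraticLoss z) C H →
        ∫ x, ((H x : ℝ) - F x) ^ 2 ∂D ≤ 10 * η := by
  have hF := hC.measurable_mem F hFC
  have := isProbabilityMeasure_labelledLaw D hF
  have hm0 : 0 < m := by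
    rcases Nat.eq_zero_or_pos m with rfl | h
    · norm_num at hm
    · exact h
  have hN0 : 0 ≤ N := by
    have : Nonempty S := nonempty_of_isProbabilityMeasure D
    simpa using hN (fun _ => Classical.arbitrary S) ∅ (by simp) (by simp)
  have hB : Measure.pi (fun _ => labelledLaw D F)
      (deviationEvent (ι := Fin m) C F (9 * η * m)) ≤
      ENNReal.ofReal (N * Real.exp (-η ^ 2 * m / 200)) := by
    refine measure_le_of_card_swaps_le _ (nullMeasurableSet_deviationEvent hC hF _) fun ζ => ?_
    have := card_swaps_mem_deviationEvent_le (ι := Fin m) (by simpa using hm0) C F hη ζ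
      (hN fun i => (ζ i).1)
    rw [Fintype.card_fin] at this ⊢
    refine this.trans_eq (by ring)
  obtain ⟨A, hA, hsub, hle⟩ := exists_measurableSet_of_ghost_sample (labelledLaw D F)
    {z : Fin m → S × Bool | ∃ H ∈ C, 10 * η < ∫ x, ((H x : ℝ) - F x) ^ 2 ∂D ∧
      ∑ i, excessLoss F H (z i) ≤ 0} (deviationEvent C F (9 * η * m)) (by
    rintro z ⟨H, hH, hI, hz⟩
    have hHm := hC.measurable_mem H hH
    rw [← integral_excessLoss D hF hHm] at hI
    refine (half_le_measure_sum_gt (ι := Fin m) (labelledLaw D F) (measurable_excessLoss hF hHm)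
      (abs_excessLoss_le F H) hη hI (by simpa using hm)).trans (measure_mono fun z' hz' => ?_)
    refine ⟨H, hH, ?_⟩
    have hz' : 9 * η * Fintype.card (Fin m) < ∑ i, excessLoss F H (z' i) := hz'
    rw [Fintype.card_fin] at hz'
    simp only [Sum.elim_inr, Sum.elim_inl, Finset.sum_sub_distrib]
    linarith)
  have hprob : IsProbabilityMeasure (sampleLaw D F m) := by unfold sampleLaw; infer_instance
  refine ⟨Aᶜ, hA.compl, ?_, ?_⟩
  · rw [probReal_compl_eq_one_sub hA]
    have h1 : sampleLaw D F m A ≤ ENNReal.ofReal (2 * (N * Real.exp (-η ^ 2 * m / 200))) := by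
      rw [ENNReal.ofReal_mul two_pos.le]
      refine hle.trans ?_
      simp only [ENNReal.ofReal_ofNat]
      gcongr
    have := ENNReal.toReal_le_of_le_ofReal (by positivity) h1
    change 1 - _ ≤ 1 - (sampleLaw D F m A).toReal
    linarith
  · intro z hz H hH hmin
    by_contra! hcon
    refine hz (hsub ⟨H, hH, hcon, ?_⟩)
    have : quadraticLoss z H ≤ quadraticLoss z F := hmin hFC
    simp only [excessLoss, Finset.sum_sub_distrib]
    unfold quadraticLoss at this
    linarith

theorem measureReal_abs_sub_gt_le {D : Measure S} [IsProbabilityMeasure D] {F H : PConcept S}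
    (hF : Measurable F) (hH : Measurable H) {γ ε : ℝ} (hγ : 0 < γ)
    (h : ∫ x, ((H x : ℝ) - F x) ^ 2 ∂D ≤ γ ^ 2 * ε) :
    D.real {x | γ < |(H x : ℝ) - (F x : ℝ)|} ≤ ε := by
  have hm : Measurable fun x => ((H x : ℝ) - F x) ^ 2 :=
    ((measurable_subtype_coe.comp hH).sub (measurable_subtype_coe.comp hF)).pow_const 2
  have hint : Integrable (fun x => ((H x : ℝ) - F x) ^ 2) D := by
    refine Integrable.of_bound hm.aestronglyMeasurable 1 (ae_of_all _ fun x => ?_)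
    rw [Real.norm_eq_abs, abs_of_nonneg (sq_nonneg _), sq_le_one_iff_abs_le_one, abs_le]
    constructor <;> linarith [(H x).2.1, (H x).2.2, (F x).2.1, (F x).2.2]
  have hmarkov := mul_meas_ge_le_integral_of_nonneg (ae_of_all D fun x => sq_nonneg _) hint (γ ^ 2)
  have hmono : D.real {x | γ < |(H x : ℝ) - (F x : ℝ)|} ≤
      D.real {x | γ ^ 2 ≤ ((H x : ℝ) - F x) ^ 2} := by
    refine measureReal_mono fun x hx => ?_
    have hx : γ < |(H x : ℝ) - (F x : ℝ)| := hx
    change γ ^ 2 ≤ _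
    rw [← sq_abs ((H x : ℝ) - F x)]
    exact pow_le_pow_left₀ hγ.le hx.le 2
  have h1 : γ ^ 2 * D.real {x | γ ^ 2 ≤ ((H x : ℝ) - F x) ^ 2} ≤ γ ^ 2 * ε := hmarkov.trans h
  exact hmono.trans (le_of_mul_le_mul_left h1 (by positivity))

end Sampling

/-! ### The sample size dominates the entropy. -/

section Numerics

theorem log_le_two_mul_sqrt {y : ℝ} (hy : 0 < y) : Real.log y ≤ 2 * √y := by
  have h1 := Real.log_le_self (Real.sqrt_nonneg y)
  have h2 : Real.log y = 2 * Real.log (√y) := by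
    rw [Real.log_sqrt hy.le]; ring
  linarith

theorem levelCount_le {η : ℝ} (hη : 0 < η) (hη1 : η ≤ 1) : (levelCount η : ℝ) ≤ 21 / η := by
  unfold levelCount
  have h1 := Nat.floor_le (show 0 ≤ 20 / η by positivity)
  have h2 : 1 ≤ 1 / η := by rwa [le_div_iff₀ hη, one_mul]
  push_cast
  calc (⌊20 / η⌋₊ : ℝ) + 1 ≤ 20 / η + 1 / η := add_le_add h1 h2
    _ = 21 / η := by ring

theorem two_le_log_one_div {η : ℝ} (hη : 0 < η) (hη1 : η ≤ 1 / 10) : 2 ≤ Real.log (1 / η) := by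
  rw [Real.le_log_iff_exp_le (by positivity)]
  have h1 : Real.exp 2 ≤ 10 := by
    have : Real.exp 2 = Real.exp 1 ^ 2 := by rw [← Real.exp_nat_mul]; norm_num
    rw [this]
    nlinarith [Real.exp_one_lt_d9, Real.exp_pos 1]
  refine h1.trans ?_
  rw [le_div_iff₀ hη]; linarith

theorem log_le_of_le_two_pow {x : ℝ} (hx : 0 < x) {k : ℕ} (h : x ≤ 2 ^ k) :
    Real.log x ≤ k * (7 / 10) := by
  have h1 := Real.log_le_log hx h
  rw [Real.log_pow] at h1
  have := Real.log_two_lt_d9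
  nlinarith [Nat.cast_nonneg (α := ℝ) k]

theorem log_mul_inv_pow {a η : ℝ} (ha : 0 < a) (hη : 0 < η) (k : ℕ) :
    Real.log (a / η ^ k) = Real.log a + k * Real.log (1 / η) := by
  rw [Real.log_div ha.ne' (by positivity), Real.log_pow, one_div, Real.log_inv]; ring

theorem entropy_bound_le {d s l : ℝ} (hd : 1 ≤ d) (hl : 2 ≤ l) (hls : 10 ^ 4 * l ≤ s) :
    (2 * (d * (2 * s + 9 * l)) + 1) * (9 * l) ≤ d * (s ^ 2 / 250) := by
  have h1 : 1 ≤ d * l := by nlinarith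
  have h2 : 10 ^ 4 * l * l ≤ s * l := mul_le_mul_of_nonneg_right hls (by linarith)
  have h3 : 10 ^ 4 * l * s ≤ s * s := mul_le_mul_of_nonneg_right hls (by linarith)
  have h4 : (4 * s + 19 * l) * (9 * l) ≤ s ^ 2 / 250 := by nlinarith
  calc _ ≤ d * (4 * s + 19 * l) * (9 * l) :=
        mul_le_mul_of_nonneg_right (by linarith) (by linarith)
    _ = d * ((4 * s + 19 * l) * (9 * l)) := by ring
    _ ≤ _ := mul_le_mul_of_nonneg_left h4 (by linarith)

/-- In terms of `y = η^2 m / d` and `l = log (1/η)`, the log-size of the net is of order `d (log y +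
l) l`. The crude `log y ≤ 2 √y` suffices, because the hypothesis gives `√y ≥ 10^4 l`, the root of
the factor `10^8`. -/
theorem exists_exponent_of_sample_size {η : ℝ} (hη : 0 < η) (hη1 : η ≤ 1 / 10) {d m : ℕ}
    (hd : 1 ≤ d) {δ : ℝ} (hδ : 0 < δ) (hδ1 : δ < 1)
    (h : 10 ^ 8 * (d * Real.log (1 / η) ^ 2 + Real.log (1 / δ)) ≤ η ^ 2 * m) :
    2 ≤ η ^ 2 * m ∧ d ≤ m + m ∧ ∃ r : ℕ,
      (Real.exp 1 * (((m + m : ℕ) : ℝ) * (levelCount η : ℝ) ^ 2 / d)) ^ d < 2 ^ r ∧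
      2 * ((40 * (levelCount η : ℝ) ^ 2 / η) ^ r * Real.exp (-η ^ 2 * m / 200)) ≤ δ := by
  have hl := two_le_log_one_div hη hη1
  set l := Real.log (1 / η) with hldef
  have hlδ : 0 < Real.log (1 / δ) := Real.log_pos (by rw [lt_div_iff₀ hδ]; linarith)
  have hd' : (1 : ℝ) ≤ d := by exact_mod_cast hd
  have hdl : (4 : ℝ) ≤ d * l ^ 2 := by nlinarith
  have hm0 : (0 : ℝ) < m := by
    by_contra hcon
    have := mul_nonpos_of_nonneg_of_nonpos (sq_nonneg η) (not_lt.1 hcon)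
    linarith
  have hb1 : (1 : ℝ) ≤ levelCount η := by exact_mod_cast Nat.succ_le_succ (Nat.zero_le _)
  have hb2 := levelCount_le hη (by linarith)
  set b : ℝ := ((levelCount η : ℕ) : ℝ) with hbdef
  have hb0 : 0 < b := by linarith
  have hbsq : b ^ 2 ≤ 441 / η ^ 2 := by
    calc b ^ 2 ≤ (21 / η) ^ 2 := pow_le_pow_left₀ hb0.le hb2 2
      _ = _ := by rw [div_pow]; norm_num
  refine ⟨by linarith, ?_, ?_⟩
  · have h1 : η ^ 2 ≤ 1 := by nlinarith
    have h2 : η ^ 2 * m ≤ m := mul_le_of_le_one_left hm0.le h1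
    have h3 : (d : ℝ) ≤ d * l ^ 2 := le_mul_of_one_le_right (by linarith) (by nlinarith)
    have h4 : (d : ℝ) ≤ m := by linarith
    have : d ≤ m := by exact_mod_cast h4
    omega
  -- the number of examples per dimension, normalised
  set y : ℝ := η ^ 2 * m / d with hydef
  have hy : 0 < y := by positivity
  have hyd : d * y = η ^ 2 * m := by rw [hydef]; field_simp
  set s := √y with hsdef
  have hs0 : 0 ≤ s := Real.sqrt_nonneg y
  have hsy : s ^ 2 = y := Real.sq_sqrt hy.le
  have hls : 10 ^ 4 * l ≤ s := by
    refine Real.le_sqrt_of_sq_le ?_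
    have : d * (10 ^ 4 * l) ^ 2 ≤ d * y := by rw [hyd]; linarith
    exact le_of_mul_le_mul_left this (by linarith)
  set Y := Real.exp 1 * (((m + m : ℕ) : ℝ) * b ^ 2 / d) with hYdef
  have hY0 : 0 < Y := by
    rw [hYdef]; push_cast; positivity
  have hYle : Y ≤ 2 ^ 12 * y / η ^ 4 := by
    have e1 : 2 ^ 12 * y / η ^ 4 = 2 ^ 12 * m / d * (1 / η ^ 2) := by
      rw [hydef]; field_simp
    have e2 : Y = (Real.exp 1 * 2) * (m / d) * b ^ 2 := by
      rw [hYdef]; push_cast; ring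
    rw [e1, e2]
    calc (Real.exp 1 * 2) * (m / d) * b ^ 2 ≤ (3 * 2) * (m / d) * (441 / η ^ 2) := by
          have := Real.exp_one_lt_d9
          gcongr
          linarith
      _ = 2646 * (m / d * (1 / η ^ 2)) := by ring
      _ ≤ 2 ^ 12 * (m / d * (1 / η ^ 2)) := by gcongr; norm_num
      _ = _ := by ring
  have hlogY : Real.log Y ≤ 2 * s + 9 * l := by
    have h1 := Real.log_le_log hY0 hYle
    rw [log_mul_inv_pow (by positivity) hη, Real.log_mul (by norm_num) hy.ne'] at h1
    have h2 := log_le_of_le_two_pow (x := 2 ^ 12) (by norm_num) le_rfl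
    have h3 := log_le_two_mul_sqrt hy
    push_cast at h1 h2
    linarith
  set M := 40 * b ^ 2 / η with hMdef
  have hM1 : 1 ≤ M := by
    rw [hMdef, le_div_iff₀ hη]; nlinarith
  have hlogM : Real.log M ≤ 9 * l := by
    have hM : M ≤ 2 ^ 15 / η ^ 3 := by
      calc M ≤ 40 * (441 / η ^ 2) / η := by rw [hMdef]; gcongr
        _ = 17640 / η ^ 3 := by field_simp; norm_num
        _ ≤ _ := by gcongr; norm_num
    have h1 := Real.log_le_log (by linarith) hM
    rw [log_mul_inv_pow (by positivity) hη] at h1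
    have h2 := log_le_of_le_two_pow (x := 2 ^ 15) (by norm_num) le_rfl
    push_cast at h1 h2
    linarith
  -- The factor `2` covers `log 2 > 1/2`; the `+ 1` makes the inequality strict.
  set r := ⌊2 * (d * (2 * s + 9 * l))⌋₊ + 1 with hrdef
  have hr0 : 0 ≤ 2 * (d * (2 * s + 9 * l)) := by positivity
  have hr1 : 2 * (d * (2 * s + 9 * l)) < r := by
    rw [hrdef]; push_cast; exact Nat.lt_floor_add_one _
  have hr2 : (r : ℝ) ≤ 2 * (d * (2 * s + 9 * l)) + 1 := by
    rw [hrdef]; push_cast; linarith [Nat.floor_le hr0]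
  have hl2 : 1 / 2 < Real.log 2 := by linarith [Real.log_two_gt_d9]
  refine ⟨r, ?_, ?_⟩
  · rw [← Real.log_lt_log_iff (by positivity) (by positivity), Real.log_pow, Real.log_pow]
    have h1 : d * Real.log Y ≤ d * (2 * s + 9 * l) := by gcongr
    have h2 : (r : ℝ) * (1 / 2) < r * Real.log 2 := by
      have : (0 : ℝ) < r := by linarith
      gcongr
    linarith
  · have hM0 : 0 < M := by linarith
    rw [← Real.log_le_log_iff (by positivity) hδ, Real.log_mul (by norm_num) (by positivity),
      Real.log_mul (by positivity) (by positivity), Real.log_pow, Real.log_exp]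
    have h1 : r * Real.log M ≤ (2 * (d * (2 * s + 9 * l)) + 1) * (9 * l) := by
      have := Real.log_nonneg hM1
      gcongr
    -- The net uses `η^2 m / 250` of the exponent `η^2 m / 200`; the difference `η^2 m / 1000` pays
    -- for `log 2 + log (1/δ)`.
    have h2 := entropy_bound_le hd' hl hls
    rw [hsy] at h2
    have h3 : Real.log (1 / δ) = - Real.log δ := by rw [one_div, Real.log_inv]
    have h4 := Real.log_two_lt_d9
    have h5 : d * (y / 250) = η ^ 2 * m / 250 := by rw [← hyd]; ring
    linarith

end Numerics

/-! ### Degenerate dimension, change of scale, and the theorem. -/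

/-- Two members `2 η` apart at a point would shatter it. This settles dimension `0`, which the
packing bound excludes. -/
theorem abs_sub_lt_of_fatDim_eq_zero {S : Type*} {C : Set (PConcept S)} {η : ℝ}
    (h0 : fatDim C η = (0 : ℕ)) {F H : PConcept S} (hF : F ∈ C) (hH : H ∈ C) (x : S) :
    |(H x : ℝ) - F x| < 2 * η := by
  by_contra hcon
  rw [not_lt] at hcon
  have key : ∀ F ∈ C, ∀ H ∈ C, (F x : ℝ) + 2 * η ≤ H x → False := by
    intro F hF H hH h
    have hs : FatShatters C η {x} := by
      refine ⟨fun _ => (F x : ℝ) + η, fun B _ => ?_⟩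
      by_cases hx : x ∈ B
      · refine ⟨H, hH, fun y hy => ?_⟩
        rw [Finset.mem_singleton.1 hy]
        exact ⟨fun h => absurd hx h, fun _ => by linarith⟩
      · refine ⟨F, hF, fun y hy => ?_⟩
        rw [Finset.mem_singleton.1 hy]
        exact ⟨fun _ => by linarith, fun h => absurd h hx⟩
    have := FatShatters.card_le_of_fatDim_eq h0 hs
    simp at this
  rcases le_abs.1 hcon with h | h
  · exact key F hF H hH (by linarith)
  · exact key H hH F hF (by linarith)

/-- This is where `c < 1` enters: `log (1/(γ ε))` stays above `log (1/c) > 0`, so a multiple of it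
absorbs `log 10`. Since `ε < 1`, `log (1/(γ^2 ε))` is at most twice `log (1/(γ ε))`. -/
theorem log_one_div_scale_le {c γ ε : ℝ} (hc0 : 0 < c) (hc : c < 1) (hγ : 0 < γ)
    (hε : 0 < ε) (hε1 : ε < 1) (h : γ * ε ≤ c) :
    Real.log (1 / (γ ^ 2 * ε / 10)) ≤
      (Real.log 10 / Real.log (1 / c) + 2) * Real.log (1 / (γ * ε)) := by
  have hlc : 0 < Real.log (1 / c) := Real.log_pos (by rw [lt_div_iff₀ hc0]; linarith)
  have hle : Real.log (1 / c) ≤ Real.log (1 / (γ * ε)) :=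
    Real.log_le_log (by positivity) (one_div_le_one_div_of_le (by positivity) h)
  have h10 : 0 < Real.log 10 := Real.log_pos (by norm_num)
  have h1 : Real.log 10 ≤ Real.log 10 / Real.log (1 / c) * Real.log (1 / (γ * ε)) := by
    rw [div_mul_eq_mul_div, le_div_iff₀ hlc]
    gcongr
  have h2 : Real.log (1 / (γ ^ 2 * ε / 10)) = Real.log 10 - 2 * Real.log γ - Real.log ε := by
    rw [one_div_div, Real.log_div (by norm_num) (by positivity),
      Real.log_mul (by positivity) hε.ne', Real.log_pow]
    push_cast; ring
  have h3 : Real.log (1 / (γ * ε)) = - Real.log γ - Real.log ε := by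
    rw [one_div, Real.log_inv, Real.log_mul hγ.ne' hε.ne']; ring
  have h4 : Real.log ε < 0 := Real.log_neg hε hε1
  rw [add_mul]
  linarith

theorem mainTheorem9 (c : ℝ) (hc : c < 1) :
    ∃ K : ℝ, 0 < K ∧
      ∀ (S : Type*) [MeasurableSpace S] (C : Set (PConcept S))
        (D : Measure S) [IsProbabilityMeasure D], MeasurableClass C D →
      ∀ F ∈ C, ∀ ε γ δ : ℝ, 0 < ε → 0 < γ → 0 < δ → γ * ε ≤ c →
      ∀ d : ℕ, fatDim C (γ ^ 2 * ε / 10) = (d : ℕ∞) →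
      ∀ m : ℕ,
        K / (γ ^ 4 * ε ^ 2) * ((d : ℝ) * Real.log (1 / (γ * ε)) ^ 2 + Real.log (1 / δ)) ≤ (m : ℝ) →
        ∃ G : Set (Fin m → S × Bool), MeasurableSet G ∧
          1 - δ ≤ (sampleLaw D F m).real G ∧
          ∀ z ∈ G, ∀ H ∈ C, IsMinOn (quadraticLoss z) C H →
            D.real {x | γ < |(H x : ℝ) - (F x : ℝ)|} ≤ ε := by
  rcases le_or_gt c 0 with hc0 | hc0
  · refine ⟨1, one_pos, ?_⟩
    intro S _ C D _ _ F _ ε γ δ hε hγ _ hγε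
    have : 0 < γ * ε := by positivity
    linarith
  set A : ℝ := Real.log 10 / Real.log (1 / c) + 2 with hA
  have hlc : 0 < Real.log (1 / c) := Real.log_pos (by rw [lt_div_iff₀ hc0]; linarith)
  have h10 : 0 < Real.log 10 := Real.log_pos (by norm_num)
  have hA1 : 1 ≤ A ^ 2 := by
    have : 0 < Real.log 10 / Real.log (1 / c) := by positivity
    exact one_le_pow₀ (by linarith)
  -- `100` comes from `η^2 = γ^4 ε^2 / 100`, `10^8` from `exists_exponent_of_sample_size`, and `A^2`
  -- from trading `log (1/η)` for `log (1/(γ ε))`.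
  refine ⟨100 * 10 ^ 8 * A ^ 2, by positivity, ?_⟩
  intro S _ C D _ hC F hF ε γ δ hε hγ hδ hγε d hd m hm
  have hFm := hC.measurable_mem F hF
  have := isProbabilityMeasure_labelledLaw D hFm
  have hprob : IsProbabilityMeasure (sampleLaw D F m) := by unfold sampleLaw; infer_instance
  -- the cases in which the conclusion holds for every hypothesis
  have htriv : (∀ H ∈ C, D.real {x | γ < |(H x : ℝ) - (F x : ℝ)|} ≤ ε) →
      ∃ G : Set (Fin m → S × Bool), MeasurableSet G ∧
          1 - δ ≤ (sampleLaw D F m).real G ∧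
          ∀ z ∈ G, ∀ H ∈ C, IsMinOn (quadraticLoss z) C H →
            D.real {x | γ < |(H x : ℝ) - (F x : ℝ)|} ≤ ε := fun h =>
    ⟨Set.univ, MeasurableSet.univ, by rw [probReal_univ]; linarith, fun _ _ H hH _ => h H hH⟩
  have hempty : ∀ H : PConcept S, (∀ x, |(H x : ℝ) - F x| ≤ γ) →
      D.real {x | γ < |(H x : ℝ) - (F x : ℝ)|} ≤ ε := by
    intro H h
    have : {x | γ < |(H x : ℝ) - (F x : ℝ)|} = ∅ :=
      Set.eq_empty_iff_forall_notMem.2 fun x hx => absurd hx (not_lt.2 (h x))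
    rw [this, measureReal_empty]
    exact hε.le
  rcases le_or_gt 1 δ with hδ1 | hδ1
  · exact ⟨∅, MeasurableSet.empty, by rw [measureReal_empty]; linarith, fun z hz => hz.elim⟩
  rcases le_or_gt 1 ε with hε1 | hε1
  · exact htriv fun H _ => measureReal_le_one.trans hε1
  rcases le_or_gt 1 γ with hγ1 | hγ1
  · refine htriv fun H _ => hempty H fun x => le_trans ?_ hγ1
    rw [abs_le]
    constructor <;> linarith [(H x).2.1, (H x).2.2, (F x).2.1, (F x).2.2]
  have hα : γ ^ 2 * ε ≤ γ := by
    have : γ * ε ≤ 1 := by linarith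
    nlinarith
  rcases Nat.eq_zero_or_pos d with rfl | hd0
  · refine htriv fun H hH => hempty H fun x => ?_
    have := abs_sub_lt_of_fatDim_eq_zero hd hF hH x
    linarith
  set η := γ ^ 2 * ε / 10 with hηdef
  have hη : 0 < η := by positivity
  have hη1 : η ≤ 1 / 10 := by linarith
  have hlog : Real.log (1 / η) ≤ A * Real.log (1 / (γ * ε)) :=
    log_one_div_scale_le hc0 hc hγ hε hε1 hγε
  have hlδ : 0 < Real.log (1 / δ) := Real.log_pos (by rw [lt_div_iff₀ hδ]; linarith)
  have hsize : 10 ^ 8 * (d * Real.log (1 / η) ^ 2 + Real.log (1 / δ)) ≤ η ^ 2 * m := by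
    have e1 : η ^ 2 * (100 * 10 ^ 8 * A ^ 2 / (γ ^ 4 * ε ^ 2) *
        ((d : ℝ) * Real.log (1 / (γ * ε)) ^ 2 + Real.log (1 / δ))) =
        10 ^ 8 * (d * (A * Real.log (1 / (γ * ε))) ^ 2 + A ^ 2 * Real.log (1 / δ)) := by
      rw [hηdef]; field_simp; ring
    have e2 := mul_le_mul_of_nonneg_left hm (sq_nonneg η)
    rw [e1] at e2
    have e3 : Real.log (1 / η) ^ 2 ≤ (A * Real.log (1 / (γ * ε))) ^ 2 :=
      pow_le_pow_left₀ (by linarith [two_le_log_one_div hη hη1]) hlog 2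
    refine le_trans ?_ e2
    gcongr
    exact le_mul_of_one_le_left hlδ.le hA1
  obtain ⟨hm2, hdm, r, hr, hfin⟩ := exists_exponent_of_sample_size hη hη1 hd0 hδ hδ1 hsize
  have hcard : Fintype.card (Fin m ⊕ Fin m) = m + m := by simp
  obtain ⟨G, hG, hGp, hGmin⟩ := exists_good_event hC hF hη hm2
    (N := (40 * (levelCount η : ℝ) ^ 2 / η) ^ r) fun x T hTC hsep =>
      (card_packing_lt hη (by linarith) hd0 hd (by rwa [hcard]) x hTC hsep (by rwa [hcard])).le
  refine ⟨G, hG, by linarith, fun z hz H hH hmin => ?_⟩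
  refine measureReal_abs_sub_gt_le hFm (hC.measurable_mem H hH) hγ ?_
  have := hGmin z hz H hH hmin
  rw [hηdef] at this
  linarith
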